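/- Let $Q:\mathbb R^n\to\mathbb R^n$ be self-adjoint positive semidefinite and linear, $A:\mathbb R^n\to\mathbb R^m$ linear, $c\in\mathbb R^n$, $\phi:\mathbb R^n\to(-\infty,+\infty]$ proper, closed and convex, and $\mathcal K=\{y\in\mathbb R^m: l_i\le y_i\le u_i,\ 1\le i\le m\}$ with $l_i,u_i\in[-\infty,+\infty]$. Let $\mathcal W=\operatorname{Range}(Q)$, let $f^*$ denote the convex conjugate of $f$, and let $\delta_{\mathcal K}$ be the indicator function of $\mathcal K$. Consider the primal problem $$\text{(P)}\quad \min_{x\in\mathbb R^n}\{\tfrac12\langle x,Qx\rangle+\langle c,x\rangle+\phi(x)\;:\;Ax\in\mathcal K\}$$ and its restricted Wolfe dual $$\text{(D)}\quad \min_{y,w,z}\{\tfrac12\langle w,Qw\rangle+\delta_{\mathcal K}^*(-y)+\phi^*(-z)\;:\;-Qw+A^*y+z=c,\ w\in\mathcal W\}.$$ Assume there is $(y^\circ,w^\circ,z^\circ,x^\circ)\in\mathbb R^m\times\mathcal W\times\mathbb R^n\times\mathbb R^n$ satisfying the KKT system $$Qw^\circ-Qx^\circ=0,\quad Ax^\circ\in\partial\delta_{\mathcal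 K}^*(-y^\circ),\quad x^\circ\in\partial\phi^*(-z^\circ),\quad -Qw^\circ+A^*y^\circ+z^\circ-c=0,$$ where subdifferentials are taken at points where the function is finite. Let $\sigma>0$, let $\lambda_Q>0$ be at least the largest eigenvalue of $Q$, put $\mathcal S_w=Q(\lambda_Q I-Q)$, and let $\mathcal S_y$ be a self-adjoint positive semidefinite operator on $\mathbb R^m$ with $\mathcal S_y+AA^*$ positive definite. Write $r(y,w,z)=-Qw+A^*y+z-c$, $\|v\|_{\mathcal S}^2=\langle v,\mathcal S v\rangle$, and $$L_\sigma(y,w,z;x)=\tfrac12\langle w,Qw\rangle+\delta_{\mathcal K}^*(-y)+\phi^*(-z)+\langle x,r(y,w,z)\rangle+\tfrac\sigma2\|r(y,w,z)\|^2 .$$ When $L_\sigma$ is minimized over one block of variables, the terms $\delta_{\mathcal K}^*(-y)$, $\phi^*(-z)$ belonging to blocks held fixed are omitted from the objective (they are additive constants, possibly $+\infty$). *sGS-based dual HPR method.* Given $u^0=(y^0,w^0,z^0,x^0)\in\mathbb R^m\times\mathcal W\times\mathbb R^n\times\mathbb R^n$, for $k=0,1,2,\dots$: 1. $\bar z^{k+1}=\arg\min_{z}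 L_\sigma(y^k,w^k,z;x^k)$; 2. $\bar x^{k+1}=x^k+\sigma\, r(y^k,w^k,\bar z^{k+1})$; 3. $\bar w^{k+1/2}=\arg\min_{w\in\mathcal W}\{L_\sigma(y^k,w,\bar z^{k+1};\bar x^{k+1})+\frac\sigma2\|w-w^k\|_{\mathcal S_w}^2\}$, then $\bar y^{k+1}=\arg\min_{y}\{L_\sigma(y,\bar w^{k+1/2},\bar z^{k+1};\bar x^{k+1})+\frac\sigma2\|y-y^k\|_{\mathcal S_y}^2\}$, then $\bar w^{k+1}=\arg\min_{w\in\mathcal W}\{L_\sigma(\bar y^{k+1},w,\bar z^{k+1};\bar x^{k+1})+\frac\sigma2\|w-w^k\|_{\mathcal S_w}^2\}$; 4. $u^{k+1}=\frac1{k+2}u^0+\frac{k+1}{k+2}(2\bar u^{k+1}-u^k)$, where $u^k=(y^k,w^k,z^k,x^k)$, $\bar u^{k}=(\bar y^{k},\bar w^{k},\bar z^{k},\bar x^{k})$. *Easy-to-implement dual HPR method.* Given $u_Q^0=(y^0,w_Q^0,z^0,x^0)\in\mathbb R^m\times\mathbb R^n\times\mathbb R^n\times\mathbb R^n$, it runs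 the same steps with $w_Q$ in place of $w$, except that the two minimizations over $\mathcal W$ are replaced by $$\bar w_Q^{k+1/2}=\tfrac1{1+\sigma\lambda_Q}\big(\sigma\lambda_Q w_Q^k+\bar x^{k+1}+\sigma\, r(y^k,w_Q^k,\bar z^{k+1})\big),\qquad \bar w_Q^{k+1}=\tfrac1{1+\sigma\lambda_Q}\big(\sigma\lambda_Q w_Q^k+\bar x^{k+1}+\sigma(-Qw_Q^k+A^*\bar y^{k+1}+\bar z^{k+1}-c)\big).$$ Then from each such initial point each method generates exactly one sequence. If the two methods are started from the same $(y^0,z^0,x^0)$ and from $w^0\in\mathcal W$, $w_Q^0\in\mathbb R^n$ with $Qw^0=Qw_Q^0$ (in particular if $w_Q^0=w^0\in\mathcal W$), then the sequence $(\bar y^k,Q\bar w_Q^k,\bar z^k,\bar x^k)_{k\ge1}$ generated by the easy-to-implement method equals the sequence $(\bar y^k,Q\bar w^k,\bar z^k,\bar x^k)_{k\ge1}$ generated by the sGS-based method, and both converge to a point $(y^*,Qw^*,z^*,x^*)$ such that $(y^*,w^*,z^*)$ solves (D) and $x^*$ solves (P). -/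

import Mathlib

open Set Filter Topology

noncomputable section

namespace DualHPR

/-- The Euclidean space `ℝ^d` with its standard inner product. -/
abbrev E (d : ℕ) : Type := EuclideanSpace ℝ (Fin d)

/-! ### Extended-real convex analysis -/

/-- `f : ℝ^d → (-∞, +∞]` is proper, closed (lower semicontinuous) and convex (convex epigraph). -/
structure ProperClosedConvex {d : ℕ} (f : E d → EReal) : Prop where
  ne_bot : ∀ x, f x ≠ ⊥
  proper : ∃ x, f x ≠ ⊤
  closed : LowerSemicontinuous f
  convex : Convex ℝ {p : E d × ℝ | f p.1 ≤ (p.2 : EReal)}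

/-- The convex conjugate `f^*(z) = sup_x (⟨x, z⟩ - f x)`. -/
def conj {d : ℕ} (f : E d → EReal) (z : E d) : EReal :=
  ⨆ x : E d, ((inner ℝ x z : ℝ) : EReal) - f x

open Classical in
/-- The indicator function of `C`: `0` on `C` and `+∞` off `C`. -/
def indicatorFun {d : ℕ} (C : Set (E d)) (x : E d) : EReal := if x ∈ C then 0 else ⊤

/-- The subdifferential of `f` at `x`; it is empty where `f` is not finite. -/
def subdiff {d : ℕ} (f : E d → EReal) (x : E d) : Set (E d) :=
  {g | f x ≠ ⊥ ∧ f x ≠ ⊤ ∧ ∀ x' : E d, f x + ((inner ℝ g (x' - x) : ℝ) : EReal) ≤ f x'}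

/-- The box `{y | l i ≤ y i ≤ u i}`; the bounds may be infinite. -/
def box {d : ℕ} (l u : Fin d → EReal) : Set (E d) :=
  {y | ∀ i, l i ≤ ((y i : ℝ) : EReal) ∧ ((y i : ℝ) : EReal) ≤ u i}

/-- `x` is an optimal solution of `min {f x | x ∈ S}`, with finite objective `f x < +∞`. -/
def Solves {X : Type} (f : X → EReal) (S : Set X) (x : X) : Prop :=
  x ∈ S ∧ f x ≠ ⊤ ∧ IsMinOn f S x

/-! ### The problem and its restricted Wolfe dual -/

/-- The data of the problem `min {½⟨x, Q x⟩ + ⟨c, x⟩ + φ(x) | A x ∈ K}`, `K` the box given by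
`lo` and `up`. -/
structure CCQP (m n : ℕ) where
  Q : E n →L[ℝ] E n
  A : E n →L[ℝ] E m
  c : E n
  phi : E n → EReal
  lo : Fin m → EReal
  up : Fin m → EReal
  Q_pos : Q.IsPositive
  phi_pcc : ProperClosedConvex phi

/-- The sequences generated by a dual HPR method. With `u^k = (y^k, w^k, z^k, x^k)`, the entries
`y k, w k, z k, x k` are the components of `u^k`, while `ybar k, wbar k, zbar k, xbar k` are the
components of `ū^{k+1}`, and `whalf k` is `w̄^{k+1/2}`. -/
structure Iterates (m n : ℕ) where
  y : ℕ → E m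
  w : ℕ → E n
  z : ℕ → E n
  x : ℕ → E n
  ybar : ℕ → E m
  whalf : ℕ → E n
  wbar : ℕ → E n
  zbar : ℕ → E n
  xbar : ℕ → E n

/-- The initial point `u^0`. -/
def Iterates.start {m n : ℕ} (r : Iterates m n) : E m × E n × E n × E n :=
  (r.y 0, r.w 0, r.z 0, r.x 0)

/-- `(1/(k+2)) v0 + ((k+1)/(k+2)) (2 vbar - v)`. -/
def halpern {V : Type} [AddCommGroup V] [Module ℝ V] (k : ℕ) (v0 v vbar : V) : V :=
  (1 / ((k : ℝ) + 2)) • v0 + (((k : ℝ) + 1) / ((k : ℝ) + 2)) • ((2 : ℝ) • vbar - v)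

/-- Steps 4 and 5: `u^{k+1} = u^0/(k+2) + (k+1)/(k+2) (2 ū^{k+1} - u^k)`, in all components. -/
def Iterates.HalpernSteps {m n : ℕ} (r : Iterates m n) : Prop :=
  ∀ k, r.y (k + 1) = halpern k (r.y 0) (r.y k) (r.ybar k) ∧
    r.w (k + 1) = halpern k (r.w 0) (r.w k) (r.wbar k) ∧
    r.z (k + 1) = halpern k (r.z 0) (r.z k) (r.zbar k) ∧
    r.x (k + 1) = halpern k (r.x 0) (r.x k) (r.xbar k)

namespace CCQP

variable {m n : ℕ} (P : CCQP m n)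

/-- The constraint set `K`. -/
def K : Set (E m) := box P.lo P.up

/-- `δ_K^*`, the conjugate of the indicator function of `K`. -/
def suppK : E m → EReal := conj (indicatorFun P.K)

/-- The conjugate `φ^*`. -/
def phiConj : E n → EReal := conj P.phi

/-- `W = Range(Q)`. -/
def W : Submodule ℝ (E n) := LinearMap.range (P.Q : E n →ₗ[ℝ] E n)

/-- `A^*`. -/
def Astar : E m →L[ℝ] E n := ContinuousLinearMap.adjoint P.A

/-- The dual residual `-Q w + A^* y + z - c`. -/
def res (y : E m) (w z : E n) : E n := -(P.Q w) + P.Astar y + z - P.c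

def primalObj (x : E n) : EReal :=
  (((1 / 2) * inner ℝ x (P.Q x) + inner ℝ P.c x : ℝ) : EReal) + P.phi x

/-- `x` solves `min {½⟨x, Q x⟩ + ⟨c, x⟩ + φ(x) | A x ∈ K}`. -/
def SolvesPrimal (x : E n) : Prop := Solves P.primalObj {x | P.A x ∈ P.K} x

def dualObj (p : E m × E n × E n) : EReal :=
  (((1 / 2) * inner ℝ p.2.1 (P.Q p.2.1) : ℝ) : EReal) + P.suppK (-p.1) + P.phiConj (-p.2.2)

/-- `(y, w, z)` solves the restricted Wolfe dual
`min {½⟨w, Q w⟩ + δ_K^*(-y) + φ^*(-z) | -Q w + A^* y + z = c, w ∈ W}`. -/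
def SolvesDual (y : E m) (w z : E n) : Prop :=
  Solves P.dualObj {p | -(P.Q p.2.1) + P.Astar p.1 + p.2.2 = P.c ∧ p.2.1 ∈ P.W} (y, w, z)

/-- The KKT system of the restricted Wolfe dual. -/
def IsKKT (y : E m) (w z x : E n) : Prop :=
  w ∈ P.W ∧ P.Q w - P.Q x = 0 ∧ P.A x ∈ subdiff P.suppK (-y) ∧
    x ∈ subdiff P.phiConj (-z) ∧ -(P.Q w) + P.Astar y + z - P.c = 0

/-! ### The augmented Lagrangian and the two algorithms

The augmented Lagrangian is `L_σ(y,w,z;x) = δ_K^*(-y) + φ^*(-z) + smoothLag σ y w z x`. In a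
subproblem that minimizes `L_σ` over one block, a term `δ_K^*(-y)` or `φ^*(-z)` of a block that is
held fixed is an additive constant; it is left out, because it can be `+∞` at the fixed point
(the Halpern iterate `y^k` need not lie in the effective domain). -/

/-- The real-valued part `½⟨w, Q w⟩ + ⟨x, r⟩ + (σ/2)‖r‖²`, `r = -Q w + A^* y + z - c`, of `L_σ`. -/
def smoothLag (σ : ℝ) (y : E m) (w z x : E n) : ℝ :=
  (1 / 2) * inner ℝ w (P.Q w) + inner ℝ x (P.res y w z) + (σ / 2) * ‖P.res y w z‖ ^ 2

/-- `zb` is a minimizer of `L_σ(y, w, z; x)` over `z ∈ ℝ^n`. -/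
def ArgminZ (σ : ℝ) (y : E m) (w x zb : E n) : Prop :=
  IsMinOn (fun z => P.phiConj (-z) + ((P.smoothLag σ y w z x : ℝ) : EReal)) univ zb

/-- `yb` is a minimizer of `L_σ(y, w, z; x) + (σ/2)‖y - y0‖²_{Sy}` over `y ∈ ℝ^m`. -/
def ArgminY (σ : ℝ) (Sy : E m →L[ℝ] E m) (y0 : E m) (w z x : E n) (yb : E m) : Prop :=
  IsMinOn (fun y => P.suppK (-y) +
    ((P.smoothLag σ y w z x + (σ / 2) * inner ℝ (y - y0) (Sy (y - y0)) : ℝ) : EReal)) univ yb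

/-- `wb` is a minimizer of `L_σ(y, w, z; x) + (σ/2)‖w - w0‖²_{Sw}` over `w ∈ W`. -/
def ArgminW (σ : ℝ) (Sw : E n →L[ℝ] E n) (w0 : E n) (y : E m) (z x : E n) (wb : E n) : Prop :=
  wb ∈ P.W ∧
    IsMinOn (fun w => P.smoothLag σ y w z x + (σ / 2) * inner ℝ (w - w0) (Sw (w - w0))) P.W wb

/-- The dual HPR method with the symmetric Gauss-Seidel technique. -/
structure IsSGSRun (σ : ℝ) (Sy : E m →L[ℝ] E m) (Sw : E n →L[ℝ] E n)
    (r : Iterates m n) : Prop where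
  init : r.w 0 ∈ P.W
  step1 : ∀ k, P.ArgminZ σ (r.y k) (r.w k) (r.x k) (r.zbar k)
  step2 : ∀ k, r.xbar k = r.x k + σ • P.res (r.y k) (r.w k) (r.zbar k)
  step3_1 : ∀ k, P.ArgminW σ Sw (r.w k) (r.y k) (r.zbar k) (r.xbar k) (r.whalf k)
  step3_2 : ∀ k, P.ArgminY σ Sy (r.y k) (r.whalf k) (r.zbar k) (r.xbar k) (r.ybar k)
  step3_3 : ∀ k, P.ArgminW σ Sw (r.w k) (r.ybar k) (r.zbar k) (r.xbar k) (r.wbar k)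
  step45 : r.HalpernSteps

/-- The operator `S_w = Q (λ_Q I - Q)`. -/
def Sw (lamQ : ℝ) : E n →L[ℝ] E n :=
  P.Q.comp (lamQ • ContinuousLinearMap.id ℝ (E n) - P.Q)

/-- `(1/(1 + σ λ_Q)) (σ λ_Q w + xb + σ (-Q w + A^* y + zb - c))`. -/
def wUpdate (σ lamQ : ℝ) (w : E n) (y : E m) (zb xb : E n) : E n :=
  (1 / (1 + σ * lamQ)) • ((σ * lamQ) • w + xb + σ • P.res y w zb)

/-- The easy-to-implement dual HPR method; the fields `w`, `whalf`, `wbar` of `r` hold the shadow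
sequences `w_Q^k`, `w̄_Q^{k+1/2}`, `w̄_Q^{k+1}`. -/
structure IsEasyRun (σ : ℝ) (Sy : E m →L[ℝ] E m) (lamQ : ℝ) (r : Iterates m n) : Prop where
  step1 : ∀ k, P.ArgminZ σ (r.y k) (r.w k) (r.x k) (r.zbar k)
  step2 : ∀ k, r.xbar k = r.x k + σ • P.res (r.y k) (r.w k) (r.zbar k)
  step3_1 : ∀ k, r.whalf k = P.wUpdate σ lamQ (r.w k) (r.y k) (r.zbar k) (r.xbar k)
  step3_2 : ∀ k, P.ArgminY σ Sy (r.y k) (r.whalf k) (r.zbar k) (r.xbar k) (r.ybar k)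
  step3_3 : ∀ k, r.wbar k = P.wUpdate σ lamQ (r.w k) (r.ybar k) (r.zbar k) (r.xbar k)
  step45 : r.HalpernSteps

/-- The element `(ȳ^{k+1}, Q w̄^{k+1}, z̄^{k+1}, x̄^{k+1})` of the sequence generated by a method. -/
def output (r : Iterates m n) (k : ℕ) : E m × E n × E n × E n :=
  (r.ybar k, P.Q (r.wbar k), r.zbar k, r.xbar k)

end CCQP

end DualHPR

end

/-!
Both methods are Halpern iterations of a degenerate proximal point step. Write `u = (y, w, z, x)`,
and let `T` be the monotone operator of the KKT system. The optimality conditions of the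
subproblems say that the step `u ↦ ū` solves `0 ∈ T ū + M (ū - u)`, where the quadratic form of `M` is
`σ⁻¹ ‖x + σ (A^* y - Q w)‖² + σ ⟨y, S_y y⟩ + σ ⟨w, S_w w⟩ + σ²/(1 + σ λ_Q) ⟨A^* y, Q A^* y⟩`. The last
term is the contribution of the symmetric Gauss-Seidel sweep. This form (`proxForm`) is positive
semidefinite, because `Q (λ_Q I - Q)` is, but it may have a kernel.

The objective of the `w`-subproblem is `(1 + σ λ_Q)/2 ⟨w - v, Q (w - v)⟩` plus a constant, with `v` the
explicit update of the easy-to-implement method. So the minimizer over `W = Range(Q)` is the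
orthogonal projection of `v` onto `W` (`Admissible.argminW_iff`), and the two methods differ only by
elements of the kernel of `Q`. As `y`, `z`, `x` depend on `w` through `Q w` only, the outputs agree
(`Admissible.output_eq`). The `y`- and `z`-subproblems minimize a conjugate function with an affine
minorant, supplied by the KKT point, plus a strongly convex quadratic, so they have exactly one
solution.

Monotonicity of `T` makes the step firmly nonexpansive for the seminorm of `M`
(`IsStep.proxForm_sub_nonneg`), hence `u ↦ 2 ū - u` is nonexpansive for it. In the finite-dimensional
quotient by the kernel of `M` the Halpern iteration converges to a fixed point
(`exists_tendsto_halpern_seminorm`). The point `(ȳ, Q w̄, z̄, x̄)` is a continuous function of the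
class of `u` in this quotient (`IsStep.tendsto`), so the outputs converge, and a step whose start and
end have the same class ends at a KKT point (`IsStep.isKKT`). A KKT point solves the dual problem by
the subgradient inequalities, and the primal problem because equality in the Fenchel–Young
inequality (`fenchel_young_eq`, by separation) turns its subgradients of `φ^*` and `δ_K^*` into
subgradients of `φ` and normals of `K`.
-/

namespace DualHPR

/-! ### Conjugate functions and their subdifferentials -/

section Convex

variable {d : ℕ}

theorem lowerSemicontinuous_conj {f : E d → EReal} : LowerSemicontinuous (conj f) := by
  unfold conj
  refine lowerSemicontinuous_iSup fun x => Continuous.lowerSemicontinuous ?_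
  induction hx : f x with
  | bot =>
    simp only [EReal.coe_sub_bot]
    exact continuous_const
  | top =>
    simp only [sub_eq_add_neg, EReal.neg_top, EReal.add_bot]
    exact continuous_const
  | coe a =>
    simp only [← EReal.coe_sub]
    exact continuous_coe_real_ereal.comp (by fun_prop)

/-- The Fenchel–Young inequality. -/
theorem inner_sub_le_conj (f : E d → EReal) (x z : E d) :
    ((inner ℝ x z : ℝ) : EReal) - f x ≤ conj f z :=
  le_iSup (fun x : E d => ((inner ℝ x z : ℝ) : EReal) - f x) x

theorem conj_convex_le {f : E d → EReal} {v v' : E d} {a b t : ℝ} (ha : conj f v ≤ a)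
    (hb : conj f v' ≤ b) (h0 : 0 ≤ t) (h1 : t ≤ 1) :
    conj f (v + t • (v' - v)) ≤ (((1 - t) * a + t * b : ℝ) : EReal) := by
  refine iSup_le fun x => ?_
  have h1' := (inner_sub_le_conj f x v).trans ha
  have h2' := (inner_sub_le_conj f x v').trans hb
  induction hx : f x with
  | bot => simp [hx] at h1'
  | top => simp
  | coe r =>
    rw [hx, ← EReal.coe_sub, EReal.coe_le_coe_iff] at h1' h2'
    rw [← EReal.coe_sub, EReal.coe_le_coe_iff, inner_add_right, inner_smul_right, inner_sub_right]
    nlinarith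

/-- At a point of the subdifferential the function is real valued, and it has an affine minorant. -/
theorem exists_coe_of_mem_subdiff {f : E d → EReal} {v g : E d} (h : g ∈ subdiff f v) :
    ∃ a : ℝ, f v = a ∧ ∀ v', ((a + inner ℝ g (v' - v) : ℝ) : EReal) ≤ f v' := by
  obtain ⟨h1, h2, h3⟩ := h
  lift f v to ℝ using ⟨h2, h1⟩ with a ha
  exact ⟨a, rfl, fun v' => by simpa using h3 v'⟩

theorem subdiff_monotone {f : E d → EReal} {v₁ v₂ g₁ g₂ : E d} (h₁ : g₁ ∈ subdiff f v₁)
    (h₂ : g₂ ∈ subdiff f v₂) : 0 ≤ inner ℝ (g₁ - g₂) (v₁ - v₂) := by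
  obtain ⟨a, ha, ha'⟩ := exists_coe_of_mem_subdiff h₁
  obtain ⟨b, hb, hb'⟩ := exists_coe_of_mem_subdiff h₂
  have h1 := ha' v₂
  have h2 := hb' v₁
  rw [hb, EReal.coe_le_coe_iff] at h1
  rw [ha, EReal.coe_le_coe_iff] at h2
  simp only [inner_sub_left, inner_sub_right] at *
  linarith

/-- The map `z ↦ ∂f(-z)` is antitone; hence a solution `z` of `ξ + H z ∈ ∂f(-z)` with `H` strongly
monotone is a Lipschitz function of `ξ`. -/
theorem norm_sub_le_of_mem_subdiff {f : E d → EReal} {z₁ z₂ ξ₁ ξ₂ : E d} {H : E d →L[ℝ] E d}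
    {μ : ℝ} (hμ : 0 < μ) (hH : ∀ v, μ * ‖v‖ ^ 2 ≤ inner ℝ v (H v))
    (h₁ : ξ₁ + H z₁ ∈ subdiff f (-z₁)) (h₂ : ξ₂ + H z₂ ∈ subdiff f (-z₂)) :
    ‖z₁ - z₂‖ ≤ μ⁻¹ * ‖ξ₁ - ξ₂‖ := by
  have h := subdiff_monotone h₁ h₂
  have e1 : -z₁ - -z₂ = -(z₁ - z₂) := by abel
  have e2 : ξ₁ + H z₁ - (ξ₂ + H z₂) = (ξ₁ - ξ₂) + H (z₁ - z₂) := by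
    rw [map_sub]; abel
  rw [e1, e2, inner_neg_right, inner_add_left, real_inner_comm (z₁ - z₂) (H _)] at h
  have h3 := hH (z₁ - z₂)
  have h4 := neg_le_of_abs_le (abs_real_inner_le_norm (ξ₁ - ξ₂) (z₁ - z₂))
  rw [inv_mul_eq_div, le_div_iff₀ hμ]
  rcases eq_or_lt_of_le (norm_nonneg (z₁ - z₂)) with h0 | h0
  · rw [← h0]; simp
  · refine le_of_mul_le_mul_right ?_ h0
    nlinarith

/-- If `x` is a subgradient of the conjugate of a proper closed convex function `f` at `v`, then
equality holds in the Fenchel–Young inequality. Otherwise `(x, ⟨x, v⟩ - f^*(v))` lies outside the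
epigraph of `f`, and a separating hyperplane contradicts the subgradient inequality. -/
theorem fenchel_young_eq {f : E d → EReal} (hf : ProperClosedConvex f) {x v : E d}
    (h : x ∈ subdiff (conj f) v) :
    ∃ a b : ℝ, f x = a ∧ conj f v = b ∧ a + b = inner ℝ x v := by
  obtain ⟨b, hb, hsub⟩ := exists_coe_of_mem_subdiff h
  have hle : f x ≤ ((inner ℝ x v - b : ℝ) : EReal) := by
    by_contra hlt
    have hcl : IsClosed {p : E d × ℝ | f p.1 ≤ (p.2 : EReal)} := by
      have := hf.closed.isClosed_epigraph
      exact this.preimage (f := fun p : E d × ℝ => (p.1, (p.2 : EReal)))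
        (continuous_fst.prodMk (continuous_coe_real_ereal.comp continuous_snd))
    obtain ⟨l, β, hlβ, hβ⟩ := geometric_hahn_banach_closed_point hf.convex hcl
      (x := (x, inner ℝ x v - b)) hlt
    -- the functional is `(x', t) ↦ ⟨p, x'⟩ + s t`
    obtain ⟨p, hp⟩ : ∃ p : E d, ∀ x', l (x', 0) = inner ℝ p x' :=
      ⟨(InnerProductSpace.toDual ℝ (E d)).symm (l.comp (ContinuousLinearMap.inl ℝ (E d) ℝ)),
        fun x' => by simp⟩
    obtain ⟨s, hs⟩ : ∃ s : ℝ, ∀ t : ℝ, l (0, t) = s * t :=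
      ⟨l (0, 1), fun t => by
        have : ((0 : E d), t) = t • ((0 : E d), (1 : ℝ)) := by simp
        rw [this, map_smul, smul_eq_mul, mul_comm]⟩
    have hl : ∀ x' t, l (x', t) = inner ℝ p x' + s * t := fun x' t => by
      rw [← hp, ← hs, ← map_add]; simp
    simp only [hl] at hlβ hβ
    have hepi : ∀ x' (t : ℝ), f x' ≤ t → inner ℝ p x' + s * t < β :=
      fun x' t ht => by simpa only [hl] using hlβ (x', t) ht
    have hs0 : s ≤ 0 := by
      by_contra hs0
      push Not at hs0
      obtain ⟨x₀, hx₀⟩ := hf.proper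
      have h0 := hf.ne_bot x₀
      lift f x₀ to ℝ using ⟨hx₀, h0⟩ with r hr
      have h1 := hepi x₀ (max r ((β - inner ℝ p x₀) / s))
        (by rw [← hr]; exact_mod_cast le_max_left _ _)
      have h2 : (β - inner ℝ p x₀) / s ≤ max r ((β - inner ℝ p x₀) / s) := le_max_right _ _
      rw [div_le_iff₀ hs0] at h2
      linarith
    rcases hs0.lt_or_eq with hs0 | rfl
    · -- a nonvertical hyperplane bounds `f^*` from above at `p / (-s)`
      have hc : conj f ((-s)⁻¹ • p) ≤ (((-s)⁻¹ * β : ℝ) : EReal) := by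
        refine iSup_le fun x' => ?_
        induction hx' : f x' with
        | bot => exact absurd hx' (hf.ne_bot x')
        | top => simp
        | coe r =>
          have := hepi x' r hx'.le
          rw [← EReal.coe_sub, EReal.coe_le_coe_iff, inner_smul_right, real_inner_comm]
          have hs' : 0 < -s := by linarith
          rw [inv_mul_eq_div, inv_mul_eq_div, sub_le_iff_le_add, div_add' _ _ _ hs'.ne']
          gcongr
          linarith
      have h1 := (hsub _).trans hc
      rw [EReal.coe_le_coe_iff, inner_sub_right, inner_smul_right, real_inner_comm] at h1
      have hs' : 0 < -s := by linarith
      have h2 : (-s)⁻¹ * (inner ℝ p x + s * (inner ℝ x v - b)) > (-s)⁻¹ * β := by gcongr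
      have h3 : (-s)⁻¹ * s = -1 := by rw [inv_neg, neg_mul, inv_mul_cancel₀ hs0.ne]
      have h4 : (-s)⁻¹ * (inner ℝ p x + s * (inner ℝ x v - b)) =
          (-s)⁻¹ * inner ℝ p x + (-s)⁻¹ * s * (inner ℝ x v - b) := by ring
      rw [h3] at h4
      linarith
    · -- a vertical hyperplane bounds the growth of `f^*` in the direction `p`
      have hc : conj f (v + p) ≤ ((b + β : ℝ) : EReal) := by
        refine iSup_le fun x' => ?_
        induction hx' : f x' with
        | bot => exact absurd hx' (hf.ne_bot x')
        | top => simp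
        | coe r =>
          have h1 := hepi x' r hx'.le
          have h2 := inner_sub_le_conj f x' v
          rw [hx', hb, ← EReal.coe_sub, EReal.coe_le_coe_iff] at h2
          rw [← EReal.coe_sub, EReal.coe_le_coe_iff, inner_add_right, real_inner_comm p x']
          linarith
      have h1 := (hsub _).trans hc
      rw [EReal.coe_le_coe_iff, add_sub_cancel_left, real_inner_comm] at h1
      linarith
  have hnb := hf.ne_bot x
  have hnt : f x ≠ ⊤ := ne_top_of_le_ne_top (EReal.coe_ne_top _) hle
  have hfy := inner_sub_le_conj f x v
  lift f x to ℝ using ⟨hnt, hnb⟩ with a ha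
  rw [hb, ← EReal.coe_sub, EReal.coe_le_coe_iff] at hfy
  rw [EReal.coe_le_coe_iff] at hle
  exact ⟨a, b, rfl, hb, by linarith⟩

/-! ### Minimization of a conjugate function plus a strongly convex quadratic -/

/-- `q` is a quadratic function with gradient `gr` and Hessian `H`. -/
def IsQuadratic (q : E d → ℝ) (gr : E d → E d) (H : E d →L[ℝ] E d) : Prop :=
  ∀ y y', q y' = q y + inner ℝ (gr y) (y' - y) + (1 / 2) * inner ℝ (y' - y) (H (y' - y))

theorem IsQuadratic.continuous {q : E d → ℝ} {gr : E d → E d} {H : E d →L[ℝ] E d}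
    (hq : IsQuadratic q gr H) : Continuous q := by
  have : q = fun y' => q 0 + inner ℝ (gr 0) (y' - 0) + (1 / 2) * inner ℝ (y' - 0) (H (y' - 0)) :=
    funext fun y' => hq 0 y'
  rw [this]
  fun_prop

/-- The subgradient gives an affine minorant of `f^*`, so the objective is coercive. -/
theorem exists_isMinOn_conj_add_quadratic {f : E d → EReal} {v g : E d}
    (h : g ∈ subdiff (conj f) v) {q : E d → ℝ} {gr : E d → E d} {H : E d →L[ℝ] E d}
    (hq : IsQuadratic q gr H) {μ : ℝ} (hμ : 0 < μ) (hH : ∀ v, μ * ‖v‖ ^ 2 ≤ inner ℝ v (H v)) :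
    ∃ z, IsMinOn (fun z => conj f (-z) + (q z : EReal)) univ z := by
  obtain ⟨a, ha, hsub⟩ := exists_coe_of_mem_subdiff h
  set R : ℝ := 2 * (‖g‖ + ‖gr (-v)‖) / μ with hR
  have hR0 : 0 ≤ R := by positivity
  have hlsc : LowerSemicontinuous (fun z => conj f (-z) + (q z : EReal)) := by
    refine LowerSemicontinuous.add' (lowerSemicontinuous_conj.comp continuous_neg)
      (continuous_coe_real_ereal.comp hq.continuous).lowerSemicontinuous fun z => ?_
    exact EReal.continuousAt_add (Or.inr (EReal.coe_ne_bot _)) (Or.inr (EReal.coe_ne_top _))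
  obtain ⟨z, -, hz⟩ := LowerSemicontinuousOn.exists_isMinOn
    (s := Metric.closedBall (-v) R) ⟨-v, by simpa using hR0⟩ (isCompact_closedBall _ _)
    (hlsc.lowerSemicontinuousOn _)
  refine ⟨z, fun z' _ => ?_⟩
  by_cases hz' : z' ∈ Metric.closedBall (-v) R
  · exact hz hz'
  · have h1 : conj f (-z) + (q z : EReal) ≤ conj f (- -v) + (q (-v) : EReal) :=
      hz (by simpa using hR0)
    refine h1.trans ?_
    have h2 : ((a + inner ℝ g (-z' - v) + q z' : ℝ) : EReal) ≤ conj f (-z') + (q z' : EReal) := by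
      rw [EReal.coe_add]
      gcongr
      exact hsub _
    refine le_trans ?_ h2
    rw [neg_neg, ha, ← EReal.coe_add, EReal.coe_le_coe_iff, hq (-v) z']
    rw [Metric.mem_closedBall, dist_eq_norm, not_le] at hz'
    have e : -z' - v = -(z' - -v) := by abel
    rw [e, inner_neg_right]
    have h3 := hH (z' - -v)
    have h4 := le_of_abs_le (abs_real_inner_le_norm g (z' - -v))
    have h5 := neg_le_of_abs_le (abs_real_inner_le_norm (gr (-v)) (z' - -v))
    have h6 : ‖g‖ + ‖gr (-v)‖ ≤ μ / 2 * ‖z' - -v‖ := by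
      rw [hR, div_lt_iff₀ hμ] at hz'
      linarith
    have h7 := mul_le_mul_of_nonneg_right h6 (norm_nonneg (z' - -v))
    nlinarith

/-- First-order optimality. -/
theorem mem_subdiff_of_isMinOn {f : E d → EReal} {v g : E d} (h : g ∈ subdiff (conj f) v)
    {q : E d → ℝ} {gr : E d → E d} {H : E d →L[ℝ] E d} (hq : IsQuadratic q gr H) {z : E d}
    (hz : IsMinOn (fun z => conj f (-z) + (q z : EReal)) univ z) :
    gr z ∈ subdiff (conj f) (-z) := by
  obtain ⟨a, ha, hsub⟩ := exists_coe_of_mem_subdiff h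
  have hbot : ∀ v', conj f v' ≠ ⊥ := fun v' h' => by
    have := hsub v'
    rw [h', le_bot_iff] at this
    exact EReal.coe_ne_bot _ this
  have hmin : ∀ z', conj f (-z) + (q z : EReal) ≤ conj f (-z') + (q z' : EReal) :=
    fun z' => hz (mem_univ z')
  have hnt : conj f (-z) ≠ ⊤ := fun ht => by
    have := hmin (-v)
    rw [ht, neg_neg, ha, EReal.top_add_coe, ← EReal.coe_add, top_le_iff] at this
    exact EReal.coe_ne_top _ this
  refine ⟨hbot _, hnt, fun v' => ?_⟩
  lift conj f (-z) to ℝ using ⟨hnt, hbot _⟩ with b hb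
  induction hv' : conj f v' with
  | bot => exact absurd hv' (hbot v')
  | top => exact le_top
  | coe r =>
    rw [← EReal.coe_add, EReal.coe_le_coe_iff]
    -- compare with the points `-z + t (v' + z)` and let `t → 0`
    have key : ∀ t : ℝ, 0 < t → t ≤ 1 →
        b + inner ℝ (gr z) (v' - -z) - r ≤
          t * ((1 / 2) * inner ℝ (v' - -z) (H (v' - -z))) := by
      intro t ht ht1
      have h1 := conj_convex_le hb.ge hv'.le ht.le ht1
      have h2 := hmin (-(-z + t • (v' - -z)))
      rw [neg_neg] at h2
      have h3 := h2.trans (add_le_add_left h1 _)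
      have e : -(-z + t • (v' - -z)) - z = -(t • (v' - -z)) := by abel
      rw [← EReal.coe_add, ← EReal.coe_add, EReal.coe_le_coe_iff, hq z (-_), e, map_neg, inner_neg_neg,
        inner_neg_right, map_smul, inner_smul_right, inner_smul_left, inner_smul_right] at h3
      simp only [conj_trivial] at h3
      refine le_of_mul_le_mul_left ?_ ht
      linarith
    have hlim : Tendsto (fun t : ℝ => t * ((1 / 2) * inner ℝ (v' - -z) (H (v' - -z))))
        (𝓝[>] 0) (𝓝 0) := by
      have : Continuous fun t : ℝ => t * ((1 / 2) * inner ℝ (v' - -z) (H (v' - -z))) := by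
        fun_prop
      simpa using (this.tendsto 0).mono_left nhdsWithin_le_nhds
    have := ge_of_tendsto hlim (b := b + inner ℝ (gr z) (v' - -z) - r) (by
      filter_upwards [Ioc_mem_nhdsGT (zero_lt_one (α := ℝ))] with t ht
      exact key t ht.1 ht.2)
    linarith

end Convex

/-! ### The Halpern iteration -/

section Halpern

theorem convex_fixedPoints {H : Type*} [NormedAddCommGroup H] [InnerProductSpace ℝ H] {T : H → H}
    (hT : ∀ a b, ‖T a - T b‖ ≤ ‖a - b‖) : Convex ℝ {p | T p = p} := by
  intro p hp q hq s t hs ht hst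
  set z := s • p + t • q with hz
  have h1 : ‖T z - p‖ ≤ t * ‖p - q‖ := by
    have := hT z p
    rw [show T p = p from hp] at this
    have e : z - p = t • (q - p) := by
      rw [hz]
      obtain rfl : s = 1 - t := by linarith
      module
    rwa [e, norm_smul, Real.norm_of_nonneg ht, norm_sub_rev q p] at this
  have h2 : ‖T z - q‖ ≤ s * ‖p - q‖ := by
    have := hT z q
    rw [show T q = q from hq] at this
    have e : z - q = s • (p - q) := by
      rw [hz]
      obtain rfl : t = 1 - s := by linarith
      module
    rwa [e, norm_smul, Real.norm_of_nonneg hs] at this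
  -- the vector `T z - z` is `s (T z - p) + t (T z - q)`
  have e : ‖T z - z‖ ^ 2 = s * ‖T z - p‖ ^ 2 + t * ‖T z - q‖ ^ 2 - s * t * ‖p - q‖ ^ 2 := by
    have e1 : T z - z = s • (T z - p) + t • (T z - q) := by
      rw [hz]
      obtain rfl : t = 1 - s := by linarith
      module
    have e2 : p - q = (T z - q) - (T z - p) := by abel
    rw [e1, e2, norm_add_sq_real, norm_sub_sq_real (T z - q), norm_smul, norm_smul,
      inner_smul_left, inner_smul_right, Real.norm_of_nonneg hs, Real.norm_of_nonneg ht,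
      real_inner_comm (T z - p) (T z - q)]
    obtain rfl : t = 1 - s := by linarith
    simp only [conj_trivial]
    ring
  have h3 : ‖T z - p‖ ^ 2 ≤ (t * ‖p - q‖) ^ 2 := by gcongr
  have h4 : ‖T z - q‖ ^ 2 ≤ (s * ‖p - q‖) ^ 2 := by gcongr
  have h5 : ‖T z - z‖ ^ 2 ≤ 0 := by
    have h6 := mul_le_mul_of_nonneg_left h3 hs
    have h7 := mul_le_mul_of_nonneg_left h4 ht
    obtain rfl : t = 1 - s := by linarith
    nlinarith
  have h6 : ‖T z - z‖ = 0 := by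
    have := sq_nonneg ‖T z - z‖
    exact pow_eq_zero_iff two_ne_zero |>.1 (le_antisymm h5 this)
  exact sub_eq_zero.1 (norm_eq_zero.1 h6)

variable {H : Type*} [NormedAddCommGroup H] [InnerProductSpace ℝ H] {T : H → H} {h : ℕ → H}

/-- The potential inequality behind the `O(1/k)` rate of the Halpern iteration. -/
theorem halpern_residual_inequality (hT : ∀ a b, ‖T a - T b‖ ≤ ‖a - b‖)
    (hh : ∀ k : ℕ, h (k + 1) =
      (1 / ((k : ℝ) + 2)) • h 0 + (((k : ℝ) + 1) / ((k : ℝ) + 2)) • T (h k)) (k : ℕ) :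
    (k : ℝ) * ‖h k - T (h k)‖ ^ 2 ≤ 2 * inner ℝ (h k - T (h k)) (h 0 - h k) := by
  induction k with
  | zero => simp
  | succ k ih =>
    have hk : (0 : ℝ) < (k : ℝ) + 2 := by positivity
    have hne := hT (h (k + 1)) (h k)
    have hne2 : ‖T (h (k + 1)) - T (h k)‖ ^ 2 ≤ ‖h (k + 1) - h k‖ ^ 2 := by gcongr
    set r := h k - T (h k) with hr
    set r' := h (k + 1) - T (h (k + 1)) with hr'
    set v := h 0 - h k with hv
    have e0 : ((k : ℝ) + 2) • (h (k + 1) - h k) = v - ((k : ℝ) + 1) • r := by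
      rw [hh k, hr, hv]
      have h1 : ((k : ℝ) + 2) * (1 / ((k : ℝ) + 2)) = 1 := by field_simp
      have h2 : ((k : ℝ) + 2) * (((k : ℝ) + 1) / ((k : ℝ) + 2)) = (k : ℝ) + 1 := by field_simp
      rw [smul_sub, smul_add, smul_smul, smul_smul, h1, h2]
      module
    set c := h (k + 1) - h k with hc
    have e1 : T (h (k + 1)) - T (h k) = c + r - r' := by rw [hc, hr, hr']; abel
    have e2 : h 0 - h (k + 1) = v - c := by rw [hv, hc]; abel
    have e3 : v = ((k : ℝ) + 2) • c + ((k : ℝ) + 1) • r := by rw [e0]; abel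
    rw [e1, norm_sub_sq_real, norm_add_sq_real] at hne2
    rw [e2, e3]
    rw [e3] at ih
    simp only [inner_add_left, inner_sub_right, inner_add_right, inner_smul_right] at *
    rw [real_inner_self_eq_norm_sq] at ih
    rw [real_inner_comm r' c, real_inner_comm r' r, real_inner_comm r c] at *
    have h1 : -‖r‖ ^ 2 ≤ 2 * inner ℝ r c := by
      refine le_of_mul_le_mul_left ?_ hk
      linarith
    have h2 : ‖r'‖ ^ 2 ≤ 2 * (inner ℝ r' c + inner ℝ r' r) := by linarith
    have h3 := mul_le_mul_of_nonneg_left h2 (by positivity : (0 : ℝ) ≤ (k : ℝ) + 1)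
    push_cast
    linarith

theorem halpern_norm_sub_le (hT : ∀ a b, ‖T a - T b‖ ≤ ‖a - b‖)
    (hh : ∀ k : ℕ, h (k + 1) =
      (1 / ((k : ℝ) + 2)) • h 0 + (((k : ℝ) + 1) / ((k : ℝ) + 2)) • T (h k))
    {p : H} (hp : T p = p) (k : ℕ) : ‖h k - p‖ ≤ ‖h 0 - p‖ := by
  induction k with
  | zero => rfl
  | succ k ih =>
    have hk : (0 : ℝ) < (k : ℝ) + 2 := by positivity
    have e : h (k + 1) - p =
        (1 / ((k : ℝ) + 2)) • (h 0 - p) + (((k : ℝ) + 1) / ((k : ℝ) + 2)) • (T (h k) - p) := by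
      have : ((k : ℝ) + 1) / ((k : ℝ) + 2) = 1 - 1 / ((k : ℝ) + 2) := by field_simp; ring
      rw [hh k, this]
      module
    have h1 : ‖T (h k) - p‖ ≤ ‖h 0 - p‖ := by
      have := hT (h k) p
      rw [hp] at this
      exact this.trans ih
    rw [e]
    refine (norm_add_le _ _).trans ?_
    rw [norm_smul, norm_smul, Real.norm_of_nonneg (by positivity),
      Real.norm_of_nonneg (by positivity)]
    calc _ ≤ 1 / ((k : ℝ) + 2) * ‖h 0 - p‖ + ((k : ℝ) + 1) / ((k : ℝ) + 2) * ‖h 0 - p‖ := by gcongr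
      _ = ‖h 0 - p‖ := by field_simp; ring

theorem halpern_residual_tendsto_zero (hT : ∀ a b, ‖T a - T b‖ ≤ ‖a - b‖)
    (hh : ∀ k : ℕ, h (k + 1) =
      (1 / ((k : ℝ) + 2)) • h 0 + (((k : ℝ) + 1) / ((k : ℝ) + 2)) • T (h k))
    {p : H} (hp : T p = p) : Tendsto (fun k => h k - T (h k)) atTop (𝓝 0) := by
  refine squeeze_zero_norm' (a := fun k : ℕ => 4 * ‖h 0 - p‖ / (k : ℝ)) ?_
    (tendsto_const_div_atTop_nhds_zero_nat _)
  filter_upwards [eventually_gt_atTop 0] with k hk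
  have hk' : (0 : ℝ) < k := by exact_mod_cast hk
  rw [le_div_iff₀ hk']
  have h1 := halpern_residual_inequality hT hh k
  have h2 := real_inner_le_norm (h k - T (h k)) (h 0 - h k)
  have h3 : ‖h 0 - h k‖ ≤ 2 * ‖h 0 - p‖ := by
    have := halpern_norm_sub_le hT hh hp k
    have e : h 0 - h k = (h 0 - p) - (h k - p) := by abel
    rw [e]
    exact (norm_sub_le _ _).trans (by linarith)
  rcases eq_or_lt_of_le (norm_nonneg (h k - T (h k))) with h0 | h0
  · rw [← h0, zero_mul]; positivity
  · refine le_of_mul_le_mul_left ?_ h0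
    have h4 := mul_le_mul_of_nonneg_left h3 h0.le
    nlinarith

/-- A Halpern iteration of a nonexpansive map that has a fixed point converges, in finite
dimensions, to a fixed point. The limit `p` is the projection of `h 0` onto the set of fixed
points; as every cluster point of `h` is a fixed point, the variational inequality of the projection
gives `limsup ⟨h 0 - p, h k - p⟩ ≤ 0`, and `‖h k - p‖²` is bounded by Cesàro means of these. -/
theorem exists_tendsto_halpern [FiniteDimensional ℝ H] (hT : ∀ a b, ‖T a - T b‖ ≤ ‖a - b‖)
    (hh : ∀ k : ℕ, h (k + 1) =
      (1 / ((k : ℝ) + 2)) • h 0 + (((k : ℝ) + 1) / ((k : ℝ) + 2)) • T (h k))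
    (hfix : ∃ p, T p = p) : ∃ p, T p = p ∧ Tendsto h atTop (𝓝 p) := by
  have hcont : Continuous T :=
    (LipschitzWith.of_dist_le_mul (K := 1) (by simpa [dist_eq_norm] using hT)).continuous
  have hconv := convex_fixedPoints hT
  obtain ⟨p, hp, hproj⟩ := exists_norm_eq_iInf_of_complete_convex (K := {p | T p = p}) hfix
    (isClosed_eq hcont continuous_id).isComplete hconv (h 0)
  rw [norm_eq_iInf_iff_real_inner_le_zero hconv hp] at hproj
  replace hp : T p = p := hp
  refine ⟨p, hp, ?_⟩
  have hbdd : ∀ k, h k ∈ Metric.closedBall p ‖h 0 - p‖ := fun k => by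
    rw [mem_closedBall_iff_norm]
    exact halpern_norm_sub_le hT hh hp k
  have hres := halpern_residual_tendsto_zero hT hh hp
  set ε : ℕ → ℝ := fun k => max 0 (inner ℝ (h 0 - p) (h k - p)) with hε
  have hε0 : Tendsto ε atTop (𝓝 0) := by
    refine tendsto_of_subseq_tendsto fun ns hns => ?_
    obtain ⟨q, -, φ, hφ, hq⟩ := (isCompact_closedBall p ‖h 0 - p‖).tendsto_subseq
      (x := fun k => h (ns k)) fun k => hbdd _
    have hq' : T q = q := by
      have h1 : Tendsto (fun k => h (ns (φ k)) - T (h (ns (φ k)))) atTop (𝓝 (q - T q)) :=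
        hq.sub ((hcont.tendsto q).comp hq)
      have h2 := hres.comp (hns.comp hφ.tendsto_atTop)
      exact (sub_eq_zero.1 (tendsto_nhds_unique h1 h2)).symm
    refine ⟨φ, ?_⟩
    have hc : Continuous fun x : H => max 0 (inner ℝ (h 0 - p) (x - p)) := by fun_prop
    have := (hc.tendsto q).comp hq
    rwa [max_eq_left (hproj q hq')] at this
  have hrec : ∀ k : ℕ, ((k : ℝ) + 2) * ‖h (k + 1) - p‖ ^ 2 ≤
      ((k : ℝ) + 1) * ‖h k - p‖ ^ 2 + 2 * ε (k + 1) := by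
    intro k
    have hk : (0 : ℝ) < (k : ℝ) + 2 := by positivity
    set s : ℝ := ((k : ℝ) + 1) / ((k : ℝ) + 2) with hs
    have hs1 : 1 / ((k : ℝ) + 2) = 1 - s := by rw [hs]; field_simp; ring
    have e : s • (T (h k) - p) = (h (k + 1) - p) - (1 - s) • (h 0 - p) := by
      rw [hh k, hs1]
      module
    have h1 : ‖s • (T (h k) - p)‖ ^ 2 ≤ s * ‖h k - p‖ ^ 2 := by
      have h2 : ‖T (h k) - p‖ ^ 2 ≤ ‖h k - p‖ ^ 2 := by
        have := hT (h k) p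
        rw [hp] at this
        gcongr
      have hs0 : 0 ≤ s := by positivity
      have hs2 : s ≤ 1 := by rw [hs, div_le_one hk]; linarith
      rw [norm_smul, mul_pow, Real.norm_of_nonneg hs0, sq s, mul_assoc]
      gcongr
      calc s * ‖T (h k) - p‖ ^ 2 ≤ 1 * ‖T (h k) - p‖ ^ 2 := by gcongr
        _ ≤ _ := by linarith
    have h3 : inner ℝ (h 0 - p) (h (k + 1) - p) ≤ ε (k + 1) := le_max_right _ _
    rw [e, norm_sub_sq_real, inner_smul_right, real_inner_comm (h 0 - p)] at h1
    have h4 : 0 ≤ ‖(1 - s) • (h 0 - p)‖ ^ 2 := by positivity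
    have h5 : (k + 2 : ℝ) * s = k + 1 := by rw [hs]; field_simp
    have h6 : (k + 2 : ℝ) * (1 - s) = 1 := by rw [mul_sub, h5]; ring
    have h7 : ‖h (k + 1) - p‖ ^ 2 ≤
        s * ‖h k - p‖ ^ 2 + 2 * ((1 - s) * inner ℝ (h 0 - p) (h (k + 1) - p)) := by linarith
    have h8 := mul_le_mul_of_nonneg_left h7 hk.le
    have h9 : (k + 2 : ℝ) *
        (s * ‖h k - p‖ ^ 2 + 2 * ((1 - s) * inner ℝ (h 0 - p) (h (k + 1) - p))) =
        ((k + 2 : ℝ) * s) * ‖h k - p‖ ^ 2 +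
          2 * (((k + 2 : ℝ) * (1 - s)) * inner ℝ (h 0 - p) (h (k + 1) - p)) := by ring
    rw [h9, h5, h6] at h8
    linarith
  have hsum : ∀ k : ℕ, ((k : ℝ) + 1) * ‖h k - p‖ ^ 2 ≤
      ‖h 0 - p‖ ^ 2 + 2 * ∑ j ∈ Finset.range k, ε (j + 1) := by
    intro k
    induction k with
    | zero => simp
    | succ k ih =>
      rw [Finset.sum_range_succ]
      push_cast
      have := hrec k
      linarith
  have hlim : Tendsto (fun k : ℕ => ‖h 0 - p‖ ^ 2 / (k : ℝ) +
      2 * ((k : ℝ)⁻¹ * ∑ j ∈ Finset.range k, ε (j + 1))) atTop (𝓝 0) := by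
    have h1 := ((tendsto_add_atTop_iff_nat 1).2 hε0).cesaro
    have h2 := (tendsto_const_div_atTop_nhds_zero_nat (‖h 0 - p‖ ^ 2)).add (h1.const_mul 2)
    simpa using h2
  have hsq : Tendsto (fun k => ‖h k - p‖ ^ 2) atTop (𝓝 0) := by
    refine squeeze_zero' (Eventually.of_forall fun k => sq_nonneg _) ?_ hlim
    filter_upwards [eventually_gt_atTop 0] with k hk
    have hk' : (0 : ℝ) < k := by exact_mod_cast hk
    have h1 := hsum k
    have h2 : (k : ℝ) * ‖h k - p‖ ^ 2 ≤
        ‖h 0 - p‖ ^ 2 + 2 * ∑ j ∈ Finset.range k, ε (j + 1) := by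
      have := sq_nonneg ‖h k - p‖
      linarith
    have e : ‖h 0 - p‖ ^ 2 / (k : ℝ) + 2 * ((k : ℝ)⁻¹ * ∑ j ∈ Finset.range k, ε (j + 1)) =
        (‖h 0 - p‖ ^ 2 + 2 * ∑ j ∈ Finset.range k, ε (j + 1)) / (k : ℝ) := by
      field_simp
    rw [e, le_div_iff₀ hk']
    linarith
  rw [tendsto_iff_norm_sub_tendsto_zero]
  have := hsq.sqrt
  simpa using this

/-- The Halpern iteration of a map `F` that is nonexpansive for the seminorm `u ↦ ‖Φ u‖`: it
converges in this seminorm, because `F` induces a nonexpansive map of the range of `Φ`. -/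
theorem exists_tendsto_halpern_seminorm [FiniteDimensional ℝ H] {U : Type*} [AddCommGroup U]
    [Module ℝ U] (Φ : U →ₗ[ℝ] H) {F : U → U} (hF : ∀ u v, ‖Φ (F u) - Φ (F v)‖ ≤ ‖Φ u - Φ v‖)
    {u : ℕ → U} (hu : ∀ k : ℕ, u (k + 1) =
      (1 / ((k : ℝ) + 2)) • u 0 + (((k : ℝ) + 1) / ((k : ℝ) + 2)) • F (u k))
    (hfix : ∃ p, Φ (F p) = Φ p) :
    ∃ q, Φ (F q) = Φ q ∧ Tendsto (fun k => Φ (u k)) atTop (𝓝 (Φ q)) := by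
  let R := LinearMap.range Φ
  let Ψ : U →ₗ[ℝ] R := Φ.rangeRestrict
  have hΨ : Function.Surjective Ψ := Φ.surjective_rangeRestrict
  let s : R → U := Function.surjInv hΨ
  have hs : ∀ a, Ψ (s a) = a := Function.surjInv_eq hΨ
  have hFΨ : ∀ u v, ‖Ψ (F u) - Ψ (F v)‖ ≤ ‖Ψ u - Ψ v‖ := hF
  let T : R → R := fun a => Ψ (F (s a))
  have hTΨ : ∀ u, T (Ψ u) = Ψ (F u) := fun u => by
    have := hFΨ (s (Ψ u)) u
    rw [hs, sub_self, norm_zero] at this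
    exact sub_eq_zero.1 (norm_le_zero_iff.1 this)
  have hT : ∀ a b, ‖T a - T b‖ ≤ ‖a - b‖ := fun a b => by
    simpa only [hs] using hFΨ (s a) (s b)
  obtain ⟨p, hp⟩ := hfix
  obtain ⟨q, hq, hlim⟩ := exists_tendsto_halpern (h := fun k => Ψ (u k)) hT
    (fun k => by rw [hTΨ]; simp only [hu k, map_add, map_smul])
    ⟨Ψ p, by rw [hTΨ]; exact Subtype.ext hp⟩
  obtain ⟨q, rfl⟩ := hΨ q
  rw [hTΨ] at hq
  exact ⟨q, congrArg Subtype.val hq, (continuous_subtype_val.tendsto _).comp hlim⟩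

end Halpern

/-! ### Positive operators in finite dimensions -/

section Positive

variable {d : ℕ}

theorem exists_inner_eq_of_isPositive {S : E d →L[ℝ] E d} (hS : S.IsPositive) :
    ∃ (k : ℕ) (R : E d →L[ℝ] E k), ∀ x y, inner ℝ (R x) (R y) = inner ℝ x (S y) := by
  obtain ⟨k, u, rfl⟩ := ContinuousLinearMap.isPositive_iff_eq_sum_rankOne.1 hS
  refine ⟨k, LinearMap.toContinuousLinearMap
    ((WithLp.linearEquiv 2 ℝ (Fin k → ℝ)).symm.toLinearMap ∘ₗ
      LinearMap.pi fun i => (innerSL ℝ (u i) : E d →ₗ[ℝ] ℝ)), fun x y => ?_⟩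
  have h : ∀ i, inner ℝ x (u i) = inner ℝ (u i) x := fun i => real_inner_comm _ _
  simp only [sum_apply, InnerProductSpace.rankOne_apply, inner_sum,
    inner_smul_right, h]
  rw [PiLp.inner_apply]
  exact Finset.sum_congr rfl fun i _ => rfl

theorem apply_eq_zero_of_inner_apply_nonpos {S : E d →L[ℝ] E d} (hS : S.IsPositive) {x : E d}
    (hx : inner ℝ x (S x) ≤ 0) : S x = 0 := by
  obtain ⟨k, R, hR⟩ := exists_inner_eq_of_isPositive hS
  have h1 : R x = 0 := by
    rw [← hR, real_inner_self_eq_norm_sq] at hx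
    have := le_antisymm hx (sq_nonneg _)
    simpa using this
  have h2 := hR (S x) x
  rw [h1, inner_zero_right] at h2
  exact inner_self_eq_zero.1 h2.symm

theorem exists_pos_mul_norm_sq_le {H : E d →L[ℝ] E d} (hH : H.IsPositive)
    (hpos : ∀ v, v ≠ 0 → 0 < inner ℝ v (H v)) :
    ∃ μ : ℝ, 0 < μ ∧ ∀ v, μ * ‖v‖ ^ 2 ≤ inner ℝ v (H v) := by
  obtain ⟨k, R, hR⟩ := exists_inner_eq_of_isPositive hH
  have hker : LinearMap.ker (R : E d →ₗ[ℝ] E k) = ⊥ := by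
    refine LinearMap.ker_eq_bot'.2 fun v hv => ?_
    by_contra h0
    have h1 := hpos v h0
    have hv' : R v = 0 := hv
    rw [← hR, hv', inner_zero_left] at h1
    exact lt_irrefl _ h1
  obtain ⟨K, hK, hanti⟩ := LinearMap.exists_antilipschitzWith (R : E d →ₗ[ℝ] E k) hker
  have hK' : (0 : ℝ) < K := hK
  refine ⟨((K : ℝ) ^ 2)⁻¹, by positivity, fun v => ?_⟩
  have h1 : ‖v‖ ≤ K * ‖R v‖ := by simpa using hanti.le_mul_dist v 0
  rw [← hR, real_inner_self_eq_norm_sq, inv_mul_le_iff₀ (by positivity), ← mul_pow]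
  gcongr

/-- `‖Q w‖² ≤ λ ⟨w, Q w⟩` when no eigenvalue of `Q` exceeds `λ`. -/
theorem norm_apply_sq_le_of_eigenvalues_le {Q : E d →L[ℝ] E d} (hQ : Q.IsPositive) {lam : ℝ}
    (hlam : ∀ μ : ℝ, Module.End.HasEigenvalue (Q : E d →ₗ[ℝ] E d) μ → μ ≤ lam) (w : E d) :
    inner ℝ (Q w) (Q w) ≤ lam * inner ℝ w (Q w) := by
  have hsym : (Q : E d →ₗ[ℝ] E d).IsSymmetric := hQ.isSymmetric
  have hn : Module.finrank ℝ (E d) = d := by simp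
  let b := hsym.eigenvectorBasis hn
  have hb : ∀ i, inner ℝ (Q w) (b i) = hsym.eigenvalues hn i * inner ℝ w (b i) := fun i => by
    have h1 : Q (b i) = hsym.eigenvalues hn i • b i := hsym.apply_eigenvectorBasis hn i
    rw [hQ.inner_left_eq_inner_right, h1, inner_smul_right]
  have hb' : ∀ i, inner ℝ (b i) (Q w) = hsym.eigenvalues hn i * inner ℝ w (b i) := fun i => by
    rw [real_inner_comm, hb]
  have hpos : (Q : E d →ₗ[ℝ] E d).IsPositive := hQ.toLinearMap
  rw [← b.sum_inner_mul_inner (Q w) (Q w), ← b.sum_inner_mul_inner w (Q w), Finset.mul_sum]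
  refine Finset.sum_le_sum fun i _ => ?_
  rw [hb, hb']
  have h0 : 0 ≤ hsym.eigenvalues hn i := hpos.nonneg_eigenvalues hn i
  have h1 : hsym.eigenvalues hn i ≤ lam := hlam _ (hsym.hasEigenvalue_eigenvalues hn i)
  have h2 := mul_le_mul_of_nonneg_right h1
    (mul_nonneg h0 (mul_self_nonneg (inner ℝ w (b i))))
  linarith

end Positive

namespace CCQP

variable {m n : ℕ}

/-! ### The three subproblems -/

/-- The standing assumptions on the parameters of the two methods, and solvability of the KKT
system. -/
structure Admissible (P : CCQP m n) (Sy : E m →L[ℝ] E m) (σ lamQ : ℝ) : Prop where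
  Sy_pos : Sy.IsPositive
  SyA_pos : ∀ y : E m, y ≠ 0 → 0 < inner ℝ y (Sy y + P.A (P.Astar y))
  sigma_pos : 0 < σ
  lamQ_pos : 0 < lamQ
  lamQ_ge : ∀ μ : ℝ, Module.End.HasEigenvalue (P.Q : E n →ₗ[ℝ] E n) μ → μ ≤ lamQ
  kkt : ∃ y w z x, P.IsKKT y w z x

variable (P : CCQP m n) {Sy : E m →L[ℝ] E m} {σ lamQ : ℝ}

theorem inner_Q_left (x y : E n) : inner ℝ (P.Q x) y = inner ℝ x (P.Q y) :=
  P.Q_pos.inner_left_eq_inner_right x y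

theorem inner_Astar_left (y : E m) (x : E n) : inner ℝ (P.Astar y) x = inner ℝ y (P.A x) :=
  ContinuousLinearMap.adjoint_inner_left _ _ _

theorem inner_Astar_right (y : E m) (x : E n) : inner ℝ x (P.Astar y) = inner ℝ (P.A x) y :=
  ContinuousLinearMap.adjoint_inner_right _ _ _

theorem inner_Sw (w w' : E n) : inner ℝ w (P.Sw lamQ w') =
    lamQ * inner ℝ w (P.Q w') - inner ℝ (P.Q w) (P.Q w') := by
  simp [Sw, inner_sub_right, inner_smul_right, inner_Q_left]

theorem Sw_isPositive
    (hlam : ∀ μ : ℝ, Module.End.HasEigenvalue (P.Q : E n →ₗ[ℝ] E n) μ → μ ≤ lamQ) :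
    (P.Sw lamQ).IsPositive := by
  rw [ContinuousLinearMap.isPositive_iff]
  have h : ∀ w w', inner ℝ (P.Sw lamQ w) w' =
      lamQ * inner ℝ w (P.Q w') - inner ℝ (P.Q w) (P.Q w') := fun w w' => by
    have h1 : inner ℝ w' (P.Q w) = inner ℝ w (P.Q w') := by rw [← inner_Q_left, real_inner_comm]
    rw [real_inner_comm, inner_Sw, h1, real_inner_comm (P.Q w)]
  refine ⟨fun w w' => ?_, fun w => ?_⟩
  · exact (h w w').trans (P.inner_Sw w w').symm
  · rw [h]
    have := norm_apply_sq_le_of_eigenvalues_le P.Q_pos hlam w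
    linarith

theorem eq_of_mem_W_of_Q_eq {w w' : E n} (hw : w ∈ P.W) (hw' : w' ∈ P.W)
    (h : P.Q w = P.Q w') : w = w' := by
  obtain ⟨v, hv⟩ : w - w' ∈ P.W := P.W.sub_mem hw hw'
  have hv' : P.Q v = w - w' := hv
  have h1 : inner ℝ (w - w') (w - w') = (0 : ℝ) := by
    nth_rewrite 1 [← hv']
    rw [inner_Q_left, map_sub, h, sub_self, inner_zero_right]
  exact sub_eq_zero.1 (inner_self_eq_zero.1 h1)

/-- The orthogonal projection onto `W = Range(Q)`. -/
noncomputable def projW (v : E n) : E n := P.W.starProjection v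

theorem projW_mem (v : E n) : P.projW v ∈ P.W := P.W.starProjection_apply_mem v

theorem Q_projW (v : E n) : P.Q (P.projW v) = P.Q v := by
  have h : v - P.projW v ∈ P.Wᗮ := P.W.sub_starProjection_mem_orthogonal v
  rw [Submodule.mem_orthogonal] at h
  have h1 := h (P.Q (P.Q (v - P.projW v))) ⟨_, rfl⟩
  rw [inner_Q_left] at h1
  have h2 := inner_self_eq_zero.1 h1
  rw [map_sub, sub_eq_zero] at h2
  exact h2.symm

theorem isQuadratic_smoothLag_z (y : E m) (w x : E n) :
    IsQuadratic (fun z => P.smoothLag σ y w z x) (fun z => x + σ • P.res y w z)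
      (σ • ContinuousLinearMap.id ℝ (E n)) := by
  intro z z'
  have e : P.res y w z' = P.res y w z + (z' - z) := by simp only [res]; abel
  simp only [smoothLag, e, norm_add_sq_real, inner_add_right, inner_add_left, inner_smul_left,
    inner_smul_right, smul_apply, ContinuousLinearMap.id_apply,
    real_inner_self_eq_norm_sq, conj_trivial]
  ring

theorem isQuadratic_smoothLag_y (hSy : Sy.IsPositive) (y0 : E m) (w z x : E n) :
    IsQuadratic (fun y => P.smoothLag σ y w z x + (σ / 2) * inner ℝ (y - y0) (Sy (y - y0)))
      (fun y => P.A x + σ • P.A (P.res y w z) + σ • Sy (y - y0))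
      (σ • (Sy + P.A.comp P.Astar)) := by
  intro y y'
  have e : P.res y' w z = P.res y w z + P.Astar (y' - y) := by
    simp only [res, map_sub]; abel
  have e' : y' - y0 = (y - y0) + (y' - y) := by abel
  have e3 : inner ℝ (y' - y) (P.A (P.Astar (y' - y))) = ‖P.Astar (y' - y)‖ ^ 2 := by
    rw [← inner_Astar_left, real_inner_self_eq_norm_sq]
  simp only [smoothLag, e, e', norm_add_sq_real, inner_add_right, inner_add_left, inner_smul_left,
    inner_smul_right, smul_apply, add_apply,
    ContinuousLinearMap.comp_apply, conj_trivial, map_add, inner_Astar_right, e3]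
  rw [← hSy.inner_left_eq_inner_right (y - y0) (y' - y),
    real_inner_comm (Sy (y - y0)) (y' - y)]
  ring

namespace Admissible

variable {P} (hP : P.Admissible Sy σ lamQ)
include hP

theorem one_add_pos : 0 < 1 + σ * lamQ := by
  have := mul_pos hP.sigma_pos hP.lamQ_pos
  linarith

theorem exists_coercive :
    ∃ μ : ℝ, 0 < μ ∧ ∀ v, μ * ‖v‖ ^ 2 ≤ inner ℝ v ((σ • (Sy + P.A.comp P.Astar)) v) := by
  have h1 : (P.A.comp P.Astar).IsPositive := ContinuousLinearMap.isPositive_self_comp_adjoint P.A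
  refine exists_pos_mul_norm_sq_le
    ((hP.Sy_pos.add h1).smul_of_nonneg hP.sigma_pos.le) fun v hv => ?_
  have := mul_pos hP.sigma_pos (hP.SyA_pos v hv)
  simpa [inner_smul_right, inner_add_right, mul_add] using this

omit hP in
theorem coercive_z (σ : ℝ) (v : E n) :
    σ * ‖v‖ ^ 2 ≤ inner ℝ v ((σ • ContinuousLinearMap.id ℝ (E n)) v) := by
  simp [inner_smul_right]

theorem mem_subdiff_of_argminZ {y : E m} {w x zb : E n} (h : P.ArgminZ σ y w x zb) :
    x + σ • P.res y w zb ∈ subdiff P.phiConj (-zb) := by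
  obtain ⟨_, _, _, _, _, _, _, hx, _⟩ := hP.kkt
  exact mem_subdiff_of_isMinOn hx (P.isQuadratic_smoothLag_z y w x) h

theorem mem_subdiff_of_argminY {y0 yb : E m} {w z x : E n} (h : P.ArgminY σ Sy y0 w z x yb) :
    P.A x + σ • P.A (P.res yb w z) + σ • Sy (yb - y0) ∈ subdiff P.suppK (-yb) := by
  obtain ⟨_, _, _, _, _, _, hy, _, _⟩ := hP.kkt
  exact mem_subdiff_of_isMinOn hy (P.isQuadratic_smoothLag_y hP.Sy_pos y0 w z x) h

theorem existsUnique_argminZ (y : E m) (w x : E n) : ∃! zb, P.ArgminZ σ y w x zb := by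
  obtain ⟨_, _, _, _, _, _, _, hx, _⟩ := hP.kkt
  obtain ⟨z, hz⟩ := exists_isMinOn_conj_add_quadratic hx (P.isQuadratic_smoothLag_z y w x)
    hP.sigma_pos (coercive_z σ)
  refine ⟨z, hz, fun z' hz' => ?_⟩
  have key : ∀ z, x + σ • P.res y w z =
      (x + σ • P.res y w 0) + (σ • ContinuousLinearMap.id ℝ (E n)) z := fun z => by
    simp only [res, smul_apply, ContinuousLinearMap.id_apply]; module
  have h1 := hP.mem_subdiff_of_argminZ hz
  have h2 := hP.mem_subdiff_of_argminZ hz'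
  rw [key] at h1 h2
  have h3 := norm_sub_le_of_mem_subdiff hP.sigma_pos (coercive_z σ) h2 h1
  rw [sub_self, norm_zero, mul_zero] at h3
  exact sub_eq_zero.1 (norm_le_zero_iff.1 h3)

omit hP in
theorem gradient_y_eq (y0 y : E m) (w z x : E n) :
    P.A x + σ • P.A (P.res y w z) + σ • Sy (y - y0) =
      (P.A x + σ • P.A (z - P.Q w - P.c) - σ • Sy y0) + (σ • (Sy + P.A.comp P.Astar)) y := by
  have e : P.res y w z = (z - P.Q w - P.c) + P.Astar y := by simp only [res]; abel
  simp only [e, map_add, map_sub, smul_apply, add_apply,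
    ContinuousLinearMap.comp_apply]
  module

theorem existsUnique_argminY (y0 : E m) (w z x : E n) : ∃! yb, P.ArgminY σ Sy y0 w z x yb := by
  obtain ⟨_, _, _, _, _, _, hy, _, _⟩ := hP.kkt
  obtain ⟨μ, hμ, hH⟩ := hP.exists_coercive
  obtain ⟨y, hy⟩ := exists_isMinOn_conj_add_quadratic hy
    (P.isQuadratic_smoothLag_y hP.Sy_pos y0 w z x) hμ hH
  refine ⟨y, hy, fun y' hy' => ?_⟩
  have h1 := hP.mem_subdiff_of_argminY hy
  have h2 := hP.mem_subdiff_of_argminY hy'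
  rw [gradient_y_eq] at h1 h2
  have h3 := norm_sub_le_of_mem_subdiff hμ hH h2 h1
  rw [sub_self, norm_zero, mul_zero] at h3
  exact sub_eq_zero.1 (norm_le_zero_iff.1 h3)

/-- Applying `Q` to the update of the easy-to-implement method. -/
theorem Q_wUpdate (w : E n) (y : E m) (z x : E n) :
    (1 + σ * lamQ) • P.Q (P.wUpdate σ lamQ w y z x) =
      P.Q ((σ * lamQ) • w + x + σ • P.res y w z) := by
  rw [wUpdate, map_smul, smul_smul, mul_one_div_cancel hP.one_add_pos.ne', one_smul]

/-- The objective of the subproblem in `w` is a multiple of `⟨w - v, Q (w - v)⟩`, up to a constant,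
for every `v` with the image under `Q` of the explicit update. -/
theorem objective_w_eq {w0 v : E n} {y : E m} {z x : E n}
    (hv : P.Q v = P.Q (P.wUpdate σ lamQ w0 y z x)) (w : E n) :
    P.smoothLag σ y w z x + (σ / 2) * inner ℝ (w - w0) (P.Sw lamQ (w - w0)) =
      P.smoothLag σ y v z x + (σ / 2) * inner ℝ (v - w0) (P.Sw lamQ (v - w0)) +
        ((1 + σ * lamQ) / 2) * inner ℝ (w - v) (P.Q (w - v)) := by
  have hv' := hP.Q_wUpdate w0 y z x
  rw [← hv] at hv'
  set e := w - v with he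
  have e1 : w = v + e := by rw [he]; abel
  have e2 : P.res y v z = P.res y w0 z - P.Q (v - w0) := by simp only [res, map_sub]; abel
  have e3 : P.res y w z = P.res y w0 z - P.Q (v - w0) - P.Q e := by
    simp only [res, e1, map_add, map_sub]; abel
  have hgrad := congrArg (fun t => inner ℝ e t) hv'
  simp only [map_add, map_smul, inner_add_right, inner_smul_right] at hgrad
  have e4 : w - w0 = (v - w0) + e := by rw [he]; abel
  set f := v - w0 with hf
  have e5 : w0 = v - f := by rw [hf]; abel
  set r := P.res y w0 z with hr
  have c1 : inner ℝ e (P.Q w0) = inner ℝ e (P.Q v) - inner ℝ e (P.Q f) := by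
    rw [e5, map_sub, inner_sub_right]
  have c2 : inner ℝ e (P.Q x) = inner ℝ x (P.Q e) := by
    rw [← inner_Q_left, real_inner_comm]
  have c3 : inner ℝ e (P.Q r) = inner ℝ r (P.Q e) := by
    rw [← inner_Q_left, real_inner_comm]
  have c4 : inner ℝ v (P.Q e) = inner ℝ e (P.Q v) := by
    rw [← inner_Q_left, real_inner_comm]
  have c5 : inner ℝ f (P.Q e) = inner ℝ e (P.Q f) := by
    rw [← inner_Q_left, real_inner_comm]
  have c6 : inner ℝ (P.Q f) (P.Q e) = inner ℝ (P.Q e) (P.Q f) := real_inner_comm _ _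
  rw [c1, c2, c3] at hgrad
  simp only [smoothLag, e3, e2, e4, inner_Sw]
  rw [e1, norm_sub_sq_real (r - P.Q f) (P.Q e)]
  simp only [map_add, inner_add_left, inner_add_right, inner_sub_left, inner_sub_right, c4, c5, c6,
    ← real_inner_self_eq_norm_sq (P.Q e)]
  linear_combination hgrad

/-- The minimizers over `W` of the subproblem in `w` are the points of `W` with the image under `Q`
of the explicit update: `Q` annihilates the component of that update orthogonal to `W`. -/
theorem argminW_iff {w0 wb : E n} {y : E m} {z x : E n} :
    P.ArgminW σ (P.Sw lamQ) w0 y z x wb ↔ wb = P.projW (P.wUpdate σ lamQ w0 y z x) := by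
  have hc := hP.one_add_pos
  constructor
  · rintro ⟨hW, hmin⟩
    have hv := P.Q_projW (P.wUpdate σ lamQ w0 y z x)
    have h1 := isMinOn_iff.1 hmin _ (P.projW_mem (P.wUpdate σ lamQ w0 y z x))
    rw [hP.objective_w_eq hv wb] at h1
    have h2 : inner ℝ (wb - P.projW (P.wUpdate σ lamQ w0 y z x))
        (P.Q (wb - P.projW (P.wUpdate σ lamQ w0 y z x))) ≤ 0 := by
      by_contra h0
      push Not at h0
      have := mul_pos (half_pos hc) h0
      linarith
    have h3 := apply_eq_zero_of_inner_apply_nonpos P.Q_pos h2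
    rw [map_sub, sub_eq_zero] at h3
    exact P.eq_of_mem_W_of_Q_eq hW (P.projW_mem _) h3
  · rintro rfl
    refine ⟨P.projW_mem _, isMinOn_iff.2 fun w _ => ?_⟩
    rw [hP.objective_w_eq (P.Q_projW _) w]
    have := mul_nonneg (half_pos hc).le
      (P.Q_pos.inner_nonneg_right (w - P.projW (P.wUpdate σ lamQ w0 y z x)))
    linarith

end Admissible

end CCQP

namespace CCQP

variable {m n : ℕ}

/-! ### One step of the methods as a degenerate proximal point step -/

/-- The points `(y, w, z, x)`. -/
abbrev State (m n : ℕ) : Type := E m × E n × E n × E n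

/-- The optimality conditions of one step of either method, from `u = (y, w, z, x)` to
`v = (ȳ, w̄, z̄, x̄)` with the intermediate point `wh`. The two updates of the `w`-block enter
through their images under `Q` only, and the old value of `z` does not enter. -/
structure IsStep (P : CCQP m n) (Sy : E m →L[ℝ] E m) (σ lamQ : ℝ) (u v : State m n) (wh : E n) :
    Prop where
  z_step : v.2.2.2 ∈ subdiff P.phiConj (-v.2.2.1)
  x_step : v.2.2.2 = u.2.2.2 + σ • P.res u.1 u.2.1 v.2.2.1
  wh_step : (1 + σ * lamQ) • P.Q wh =
    P.Q ((σ * lamQ) • u.2.1 + v.2.2.2 + σ • P.res u.1 u.2.1 v.2.2.1)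
  y_step : P.A v.2.2.2 + σ • P.A (P.res v.1 wh v.2.2.1) + σ • Sy (v.1 - u.1) ∈
    subdiff P.suppK (-v.1)
  w_step : (1 + σ * lamQ) • P.Q v.2.1 =
    P.Q ((σ * lamQ) • u.2.1 + v.2.2.2 + σ • P.res v.1 u.2.1 v.2.2.1)

variable (P : CCQP m n) (Sy : E m →L[ℝ] E m) (σ lamQ : ℝ)

/-- `x + σ (A^* y - Q w)`, the only combination of `y, w, x` that enters the `z`-subproblem. -/
noncomputable def multiplier (u : State m n) : E n := u.2.2.2 + σ • (P.Astar u.1 - P.Q u.2.1)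

/-- The positive semidefinite bilinear form of the proximal term that makes the step from `u` to
`ū` the resolvent step `0 ∈ T ū + M (ū - u)` of the KKT operator `T`. -/
noncomputable def proxForm (u v : State m n) : ℝ :=
  σ⁻¹ * inner ℝ (P.multiplier σ u) (P.multiplier σ v) + σ * inner ℝ u.1 (Sy v.1) +
    σ * inner ℝ u.2.1 (P.Sw lamQ v.2.1) +
      σ ^ 2 / (1 + σ * lamQ) * inner ℝ (P.Astar u.1) (P.Q (P.Astar v.1))

variable {P Sy σ lamQ}

/-- The linear identity behind the monotonicity of the step map, for the difference `u` of two
starting points and the difference `v` of the two results. -/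
theorem proxForm_sub_eq (hσ : 0 < σ) (hc : 0 < 1 + σ * lamQ)
    {u v : State m n} {wh : E n}
    (hx : v.2.2.2 = u.2.2.2 + σ • (-P.Q u.2.1 + P.Astar u.1 + v.2.2.1))
    (hwh : (1 + σ * lamQ) • P.Q wh =
      P.Q ((σ * lamQ) • u.2.1 + v.2.2.2 + σ • (-P.Q u.2.1 + P.Astar u.1 + v.2.2.1)))
    (hw : (1 + σ * lamQ) • P.Q v.2.1 =
      P.Q ((σ * lamQ) • u.2.1 + v.2.2.2 + σ • (-P.Q u.2.1 + P.Astar v.1 + v.2.2.1))) :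
    P.proxForm Sy σ lamQ v (u - v) =
      inner ℝ v.2.1 (P.Q v.2.1) - inner ℝ v.2.2.2 v.2.2.1 -
        inner ℝ v.1 (P.A v.2.2.2 + σ • P.A (-P.Q wh + P.Astar v.1 + v.2.2.1) +
          σ • Sy (v.1 - u.1)) := by
  obtain ⟨y, w, z, x⟩ := u
  obtain ⟨y', w', z', x'⟩ := v
  dsimp only at *
  -- the linear part of the dual residual at the new point
  set r := -P.Q w' + P.Astar y' + z' with hr
  have hmul : P.multiplier σ ((y, w, z, x) - (y', w', z', x')) = -σ • r := by
    simp only [multiplier, Prod.mk_sub_mk, map_sub, hr]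
    rw [hx]
    module
  have hQ : (1 + σ * lamQ) • (P.Q w' - P.Q wh) = σ • P.Q (P.Astar (y' - y)) := by
    rw [smul_sub, hw, hwh]
    simp only [map_add, map_smul, map_sub, map_neg]
    module
  have hSw : σ • P.Sw lamQ (w - w') = P.Q w' - P.Q x' - σ • P.Q r := by
    have : σ • P.Sw lamQ (w - w') = (P.Q w' - P.Q x' - σ • P.Q r) +
        (P.Q ((σ * lamQ) • w + x' + σ • (-P.Q w + P.Astar y' + z')) -
          (1 + σ * lamQ) • P.Q w') := by
      simp only [Sw, hr, map_add, map_smul, map_sub, map_neg, ContinuousLinearMap.comp_apply,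
        sub_apply, smul_apply, ContinuousLinearMap.id_apply]
      module
    rw [this, ← hw, sub_self, add_zero]
  have e1 : -P.Q wh + P.Astar y' + z' = r + (P.Q w' - P.Q wh) := by rw [hr]; abel
  have t1 : σ⁻¹ * inner ℝ (P.multiplier σ (y', w', z', x')) (-σ • r) =
      -(inner ℝ x' r + σ * (inner ℝ (P.Astar y') r - inner ℝ (P.Q w') r)) := by
    simp only [multiplier, inner_add_left, inner_smul_left, inner_smul_right, inner_sub_left,
      conj_trivial]
    field_simp
  have t2 : σ * inner ℝ w' (P.Sw lamQ (w - w')) =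
      inner ℝ w' (P.Q w') - inner ℝ w' (P.Q x') - σ * inner ℝ (P.Q w') r := by
    rw [← inner_smul_right, hSw]
    simp only [inner_sub_right, inner_smul_right, inner_Q_left]
  have t3 : σ ^ 2 / (1 + σ * lamQ) * inner ℝ (P.Astar y') (P.Q (P.Astar (y - y'))) =
      -(σ * inner ℝ (P.Astar y') (P.Q w' - P.Q wh)) := by
    have h1 : P.Q (P.Astar (y - y')) = -P.Q (P.Astar (y' - y)) := by
      rw [← map_neg, ← map_neg, neg_sub]
    have h2 := congrArg (fun t => inner ℝ (P.Astar y') t) hQ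
    simp only [inner_smul_right] at h2
    rw [h1, inner_neg_right, div_mul_eq_mul_div, div_eq_iff hc.ne']
    linear_combination σ * h2
  have t4 : inner ℝ x' r = inner ℝ x' z' + inner ℝ (P.Astar y') x' - inner ℝ w' (P.Q x') := by
    rw [hr, inner_add_right, inner_add_right, inner_neg_right, real_inner_comm (P.Astar y') x',
      real_inner_comm (P.Q w') x', inner_Q_left]
    ring
  have t5 : inner ℝ y' (Sy (y - y')) = -inner ℝ y' (Sy (y' - y)) := by
    rw [← inner_neg_right, ← map_neg, neg_sub]
  rw [proxForm, hmul, t1]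
  simp only [Prod.mk_sub_mk]
  rw [t2, t3, t4, t5, e1]
  simp only [inner_add_right, inner_smul_right, map_add, ← inner_Astar_left]
  ring

/-- Two steps satisfy the inequality of firm nonexpansiveness for the form `proxForm`. -/
theorem IsStep.proxForm_sub_nonneg (hP : P.Admissible Sy σ lamQ) {u₁ u₂ v₁ v₂ : State m n}
    {wh₁ wh₂ : E n} (h₁ : P.IsStep Sy σ lamQ u₁ v₁ wh₁) (h₂ : P.IsStep Sy σ lamQ u₂ v₂ wh₂) :
    0 ≤ P.proxForm Sy σ lamQ (v₁ - v₂) ((u₁ - u₂) - (v₁ - v₂)) := by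
  have hz := subdiff_monotone h₁.z_step h₂.z_step
  have hy := subdiff_monotone h₁.y_step h₂.y_step
  have hw := P.Q_pos.inner_nonneg_right (v₁ - v₂).2.1
  have hx : ∀ (y₁ y₂ : E m) (w₁ w₂ z₁ z₂ : E n), P.res y₁ w₁ z₁ - P.res y₂ w₂ z₂ =
      -P.Q (w₁ - w₂) + P.Astar (y₁ - y₂) + (z₁ - z₂) := fun y₁ y₂ w₁ w₂ z₁ z₂ => by
    simp only [res, map_sub]; abel
  rw [proxForm_sub_eq (wh := wh₁ - wh₂) hP.sigma_pos hP.one_add_pos]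
  · have e1 : -v₁.2.2.1 - -v₂.2.2.1 = -(v₁ - v₂).2.2.1 := by
      rw [Prod.snd_sub, Prod.snd_sub, Prod.fst_sub]; abel
    have e2 : -v₁.1 - -v₂.1 = -(v₁ - v₂).1 := by rw [Prod.fst_sub]; abel
    have e3 : P.A v₁.2.2.2 + σ • P.A (P.res v₁.1 wh₁ v₁.2.2.1) + σ • Sy (v₁.1 - u₁.1) -
        (P.A v₂.2.2.2 + σ • P.A (P.res v₂.1 wh₂ v₂.2.2.1) + σ • Sy (v₂.1 - u₂.1)) =
        P.A (v₁ - v₂).2.2.2 + σ • P.A (-P.Q (wh₁ - wh₂) + P.Astar (v₁ - v₂).1 +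
          (v₁ - v₂).2.2.1) + σ • Sy ((v₁ - v₂).1 - (u₁ - u₂).1) := by
      simp only [Prod.fst_sub, Prod.snd_sub]
      rw [← hx]
      simp only [map_sub]
      module
    rw [e1, inner_neg_right] at hz
    rw [e2, e3, inner_neg_right, real_inner_comm] at hy
    rw [Prod.snd_sub, Prod.snd_sub, Prod.snd_sub] at *
    linarith
  · simp only [Prod.fst_sub, Prod.snd_sub]
    rw [← hx, h₁.x_step, h₂.x_step]
    module
  · simp only [Prod.fst_sub, Prod.snd_sub]
    rw [← hx, map_sub, smul_sub, h₁.wh_step, h₂.wh_step, ← map_sub]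
    congr 1
    module
  · simp only [Prod.fst_sub, Prod.snd_sub]
    rw [← hx, map_sub, smul_sub, h₁.w_step, h₂.w_step, ← map_sub]
    congr 1
    module

/-- The form `proxForm` is the pullback of an inner product along a linear map `Φ`, and the data of
`u` on which a step from `u` depends are continuous functions of `Φ u`. -/
theorem exists_inner_eq_proxForm (hP : P.Admissible Sy σ lamQ) :
    ∃ (k₁ k₂ k₃ k₄ : ℕ)
      (Φ : State m n →ₗ[ℝ] WithLp 2 (E k₁ × WithLp 2 (E k₂ × WithLp 2 (E k₃ × E k₄)))),
      (∀ u v, inner ℝ (Φ u) (Φ v) = P.proxForm Sy σ lamQ u v) ∧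
      ∀ (u : ℕ → State m n) (v : State m n), Tendsto (fun k => Φ (u k)) atTop (𝓝 (Φ v)) →
        Tendsto (fun k => P.multiplier σ (u k)) atTop (𝓝 (P.multiplier σ v)) ∧
        Tendsto (fun k => Sy (u k).1) atTop (𝓝 (Sy v.1)) ∧
        Tendsto (fun k => P.Sw lamQ (u k).2.1) atTop (𝓝 (P.Sw lamQ v.2.1)) ∧
        Tendsto (fun k => P.Q (P.Astar (u k).1)) atTop (𝓝 (P.Q (P.Astar v.1))) := by
  obtain ⟨k₂, R₂, h₂⟩ := exists_inner_eq_of_isPositive hP.Sy_pos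
  obtain ⟨k₃, R₃, h₃⟩ := exists_inner_eq_of_isPositive (P.Sw_isPositive hP.lamQ_ge)
  obtain ⟨k₄, R₄, h₄⟩ := exists_inner_eq_of_isPositive P.Q_pos
  have hσ := hP.sigma_pos
  have hc := hP.one_add_pos
  have hs1 : √σ ≠ 0 := (Real.sqrt_pos.2 hσ).ne'
  have hc1 : √(1 + σ * lamQ) ≠ 0 := (Real.sqrt_pos.2 hc).ne'
  let mul : State m n →ₗ[ℝ] E n :=
    { toFun := P.multiplier σ
      map_add' := fun u v => by
        simp only [multiplier, Prod.fst_add, Prod.snd_add, map_add]; module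
      map_smul' := fun t u => by
        simp only [multiplier, Prod.smul_fst, Prod.smul_snd, map_smul, RingHom.id_apply]; module }
  let Φ : State m n →ₗ[ℝ] WithLp 2 (E n × WithLp 2 (E k₂ × WithLp 2 (E k₃ × E k₄))) :=
    { toFun := fun u => WithLp.toLp 2 ((√σ)⁻¹ • mul u, WithLp.toLp 2 (√σ • R₂ u.1,
        WithLp.toLp 2 (√σ • R₃ u.2.1, (σ / √(1 + σ * lamQ)) • R₄ (P.Astar u.1))))
      map_add' := fun u v => by
        simp only [Prod.fst_add, Prod.snd_add, map_add, smul_add, ← WithLp.toLp_add,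
          Prod.mk_add_mk]
      map_smul' := fun t u => by
        simp only [Prod.smul_fst, Prod.smul_snd, map_smul, RingHom.id_apply, ← WithLp.toLp_smul,
          Prod.smul_mk, smul_comm _ t] }
  -- the operators are recovered from their factors by applying the adjoint factor
  have hadj : ∀ {d k : ℕ} {S : E d →L[ℝ] E d} {R : E d →L[ℝ] E k},
      (∀ x y, inner ℝ (R x) (R y) = inner ℝ x (S y)) →
        ∀ x, S x = ContinuousLinearMap.adjoint R (R x) := by
    intro d k S R h x
    refine ext_inner_left ℝ fun v => ?_
    rw [ContinuousLinearMap.adjoint_inner_right, h]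
  refine ⟨n, k₂, k₃, k₄, Φ, fun u v => ?_, fun u v huv => ?_⟩
  · have q1 : (√σ)⁻¹ * (√σ)⁻¹ = σ⁻¹ := by rw [← mul_inv, Real.mul_self_sqrt hσ.le]
    have q2 : √σ * √σ = σ := Real.mul_self_sqrt hσ.le
    have q3 : (σ / √(1 + σ * lamQ)) * (σ / √(1 + σ * lamQ)) = σ ^ 2 / (1 + σ * lamQ) := by
      rw [div_mul_div_comm, Real.mul_self_sqrt hc.le, sq]
    simp only [Φ, mul, LinearMap.coe_mk, AddHom.coe_mk, WithLp.prod_inner_apply, inner_smul_left,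
      inner_smul_right, conj_trivial, h₂, h₃, h₄, ← mul_assoc, q1, q2, q3, proxForm]
    ring
  · have c1 : Tendsto (fun k => (Φ (u k)).fst) atTop (𝓝 (Φ v).fst) :=
      ((WithLp.continuous_fst 2 _ _).tendsto _).comp huv
    have c2 : Tendsto (fun k => (Φ (u k)).snd) atTop (𝓝 (Φ v).snd) :=
      ((WithLp.continuous_snd 2 _ _).tendsto _).comp huv
    have c3 : Tendsto (fun k => (Φ (u k)).snd.fst) atTop (𝓝 (Φ v).snd.fst) :=
      ((WithLp.continuous_fst 2 _ _).tendsto _).comp c2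
    have c4 : Tendsto (fun k => (Φ (u k)).snd.snd) atTop (𝓝 (Φ v).snd.snd) :=
      ((WithLp.continuous_snd 2 _ _).tendsto _).comp c2
    have c5 : Tendsto (fun k => (Φ (u k)).snd.snd.fst) atTop (𝓝 (Φ v).snd.snd.fst) :=
      ((WithLp.continuous_fst 2 _ _).tendsto _).comp c4
    have c6 : Tendsto (fun k => (Φ (u k)).snd.snd.snd) atTop (𝓝 (Φ v).snd.snd.snd) :=
      ((WithLp.continuous_snd 2 _ _).tendsto _).comp c4
    have hne : σ / √(1 + σ * lamQ) ≠ 0 := div_ne_zero hσ.ne' hc1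
    have f1 : ∀ u, (Φ u).fst = (√σ)⁻¹ • P.multiplier σ u := fun _ => rfl
    have f3 : ∀ u, (Φ u).snd.fst = √σ • R₂ u.1 := fun _ => rfl
    have f5 : ∀ u, (Φ u).snd.snd.fst = √σ • R₃ u.2.1 := fun _ => rfl
    have f6 : ∀ u, (Φ u).snd.snd.snd = (σ / √(1 + σ * lamQ)) • R₄ (P.Astar u.1) := fun _ => rfl
    replace c1 := c1.const_smul (√σ)
    replace c3 := c3.const_smul (√σ)⁻¹
    replace c5 := c5.const_smul (√σ)⁻¹
    replace c6 := c6.const_smul (σ / √(1 + σ * lamQ))⁻¹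
    simp only [f1, f3, f5, f6, smul_smul, mul_inv_cancel₀ hs1, inv_mul_cancel₀ hs1,
      inv_mul_cancel₀ hne, one_smul] at c1 c3 c5 c6
    simp only [hadj h₂, hadj h₃, hadj h₄]
    exact ⟨c1, ((ContinuousLinearMap.continuous _).tendsto _).comp c3,
      ((ContinuousLinearMap.continuous _).tendsto _).comp c5,
      ((ContinuousLinearMap.continuous _).tendsto _).comp c6⟩

end CCQP

namespace CCQP

variable {m n : ℕ} {P : CCQP m n} {Sy : E m →L[ℝ] E m} {σ lamQ : ℝ}

/-! ### Continuity of the step -/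

variable (P) in
/-- The point `(y, Q w, z, x)`. -/
def imageState (u : State m n) : E m × E n × E n × E n := (u.1, P.Q u.2.1, u.2.2.1, u.2.2.2)

theorem IsStep.x_eq {u v : State m n} {wh : E n} (h : P.IsStep Sy σ lamQ u v wh) :
    v.2.2.2 = P.multiplier σ u + σ • (v.2.2.1 - P.c) := by
  rw [h.x_step, multiplier, res]
  module

theorem IsStep.Q_wh_eq {u v : State m n} {wh : E n} (h : P.IsStep Sy σ lamQ u v wh) :
    (1 + σ * lamQ) • P.Q wh = σ • P.Sw lamQ u.2.1 +
      P.Q ((2 : ℝ) • v.2.2.2 - P.multiplier σ u) + σ • P.Q (P.Astar u.1) := by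
  have h1 : σ • P.res u.1 u.2.1 v.2.2.1 = v.2.2.2 - u.2.2.2 := by rw [h.x_step]; abel
  rw [h.wh_step, h1]
  simp only [multiplier, Sw, map_add, map_sub, map_smul, ContinuousLinearMap.comp_apply,
    sub_apply, smul_apply, ContinuousLinearMap.id_apply]
  module

theorem IsStep.Q_w_eq {u v : State m n} {wh : E n} (h : P.IsStep Sy σ lamQ u v wh) :
    (1 + σ * lamQ) • P.Q v.2.1 = (1 + σ * lamQ) • P.Q wh +
      σ • (P.Q (P.Astar v.1) - P.Q (P.Astar u.1)) := by
  rw [h.w_step, h.wh_step]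
  simp only [res, map_add, map_sub, map_smul, map_neg]
  module

/-- The result of a step, with the `w`-block replaced by its image under `Q`, depends continuously
on the four data listed: the `z`- and `y`-subproblems are strongly monotone inclusions. -/
theorem IsStep.tendsto (hP : P.Admissible Sy σ lamQ) {u v : ℕ → State m n} {wh : ℕ → E n}
    {u' v' : State m n} {wh' : E n} (h : ∀ k, P.IsStep Sy σ lamQ (u k) (v k) (wh k))
    (h' : P.IsStep Sy σ lamQ u' v' wh')
    (h1 : Tendsto (fun k => P.multiplier σ (u k)) atTop (𝓝 (P.multiplier σ u')))
    (h2 : Tendsto (fun k => Sy (u k).1) atTop (𝓝 (Sy u'.1)))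
    (h3 : Tendsto (fun k => P.Sw lamQ (u k).2.1) atTop (𝓝 (P.Sw lamQ u'.2.1)))
    (h4 : Tendsto (fun k => P.Q (P.Astar (u k).1)) atTop (𝓝 (P.Q (P.Astar u'.1)))) :
    Tendsto (fun k => P.imageState (v k)) atTop (𝓝 (P.imageState v')) := by
  have hσ := hP.sigma_pos
  have hc := hP.one_add_pos
  have lip : ∀ {d : ℕ} {z ξ : ℕ → E d} {z' ξ' : E d} {C : ℝ}, Tendsto ξ atTop (𝓝 ξ') →
      (∀ k, ‖z k - z'‖ ≤ C * ‖ξ k - ξ'‖) → Tendsto z atTop (𝓝 z') := by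
    intro d z ξ z' ξ' C hξ hz
    rw [tendsto_iff_norm_sub_tendsto_zero] at hξ ⊢
    exact squeeze_zero (fun k => norm_nonneg _) hz (by simpa using hξ.const_mul C)
  have cancel : ∀ {ξ : ℕ → E n} {ξ' : E n},
      Tendsto (fun k => (1 + σ * lamQ) • ξ k) atTop (𝓝 ((1 + σ * lamQ) • ξ')) →
        Tendsto ξ atTop (𝓝 ξ') := by
    intro ξ ξ' hξ
    simpa [smul_smul, inv_mul_cancel₀ hc.ne'] using hξ.const_smul (1 + σ * lamQ)⁻¹
  have hz : Tendsto (fun k => (v k).2.2.1) atTop (𝓝 v'.2.2.1) := by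
    have key : ∀ {u v : State m n} {wh : E n}, P.IsStep Sy σ lamQ u v wh →
        (P.multiplier σ u - σ • P.c) + (σ • ContinuousLinearMap.id ℝ (E n)) v.2.2.1 ∈
          subdiff P.phiConj (-v.2.2.1) := by
      intro u v wh h
      have e : (P.multiplier σ u - σ • P.c) + (σ • ContinuousLinearMap.id ℝ (E n)) v.2.2.1 =
          v.2.2.2 := by
        rw [h.x_eq, smul_apply, ContinuousLinearMap.id_apply]
        module
      rw [e]
      exact h.z_step
    exact lip (h1.sub_const (σ • P.c)) fun k =>
      norm_sub_le_of_mem_subdiff hσ (Admissible.coercive_z σ) (key (h k)) (key h')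
  have hx : Tendsto (fun k => (v k).2.2.2) atTop (𝓝 v'.2.2.2) := by
    rw [h'.x_eq]
    simp only [(h _).x_eq]
    exact h1.add ((hz.sub_const _).const_smul σ)
  have hwh : Tendsto (fun k => P.Q (wh k)) atTop (𝓝 (P.Q wh')) := by
    refine cancel ?_
    rw [h'.Q_wh_eq]
    simp only [(h _).Q_wh_eq]
    exact ((h3.const_smul σ).add
      ((P.Q.continuous.tendsto _).comp ((hx.const_smul (2 : ℝ)).sub h1))).add (h4.const_smul σ)
  have hy : Tendsto (fun k => (v k).1) atTop (𝓝 v'.1) := by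
    obtain ⟨μ, hμ, hH⟩ := hP.exists_coercive
    have hy' := h'.y_step
    have hyk := fun k => (h k).y_step
    rw [Admissible.gradient_y_eq] at hy'
    simp only [Admissible.gradient_y_eq] at hyk
    refine lip (C := μ⁻¹) ?_ fun k => norm_sub_le_of_mem_subdiff hμ hH (hyk k) hy'
    exact (((P.A.continuous.tendsto _).comp hx).add (((P.A.continuous.tendsto _).comp
      ((hz.sub hwh).sub_const P.c)).const_smul σ)).sub (h2.const_smul σ)
  have hw : Tendsto (fun k => P.Q (v k).2.1) atTop (𝓝 (P.Q v'.2.1)) := by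
    refine cancel ?_
    rw [h'.Q_w_eq]
    simp only [(h _).Q_w_eq]
    have hA : Tendsto (fun k => P.Q (P.Astar (v k).1)) atTop (𝓝 (P.Q (P.Astar v'.1))) :=
      ((P.Q.comp P.Astar).continuous.tendsto _).comp hy
    exact (hwh.const_smul _).add ((hA.sub h4).const_smul σ)
  exact hy.prodMk_nhds (hw.prodMk_nhds (hz.prodMk_nhds hx))

theorem IsStep.imageState_eq (hP : P.Admissible Sy σ lamQ) {u₁ u₂ v₁ v₂ : State m n}
    {wh₁ wh₂ : E n} (h₁ : P.IsStep Sy σ lamQ u₁ v₁ wh₁) (h₂ : P.IsStep Sy σ lamQ u₂ v₂ wh₂)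
    (hu : P.imageState u₁ = P.imageState u₂) : P.imageState v₁ = P.imageState v₂ := by
  simp only [imageState, Prod.mk.injEq] at hu
  obtain ⟨hy, hw, hz, hx⟩ := hu
  have e1 : P.multiplier σ u₁ = P.multiplier σ u₂ := by simp only [multiplier, hy, hw, hx]
  have e2 : P.Sw lamQ u₁.2.1 = P.Sw lamQ u₂.2.1 := by simp [Sw, hw]
  refine tendsto_nhds_unique (tendsto_const_nhds (f := (atTop : Filter ℕ)))
    (IsStep.tendsto hP (u := fun _ => u₁) (fun _ => h₁) h₂ ?_ ?_ ?_ ?_)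
  · rw [e1]; exact tendsto_const_nhds
  · rw [hy]; exact tendsto_const_nhds
  · rw [e2]; exact tendsto_const_nhds
  · rw [hy]; exact tendsto_const_nhds

/-! ### Fixed points, KKT points and solutions -/

theorem isStep_of_isKKT {y : E m} {w z x : E n} (h : P.IsKKT y w z x) :
    P.IsStep Sy σ lamQ (y, w, z, x) (y, w, z, x) w := by
  obtain ⟨-, hQ, hy, hz, hr⟩ := h
  have hr' : P.res y w z = 0 := hr
  have hQ' := sub_eq_zero.1 hQ
  have hw : (1 + σ * lamQ) • P.Q w = P.Q ((σ * lamQ) • w + x + σ • P.res y w z) := by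
    rw [hr', smul_zero, add_zero, map_add, map_smul, ← hQ']
    module
  exact ⟨hz, by simp [hr'], hw, by simpa [hr'] using hy, hw⟩

/-- A step along the kernel of `proxForm` ends at a KKT point. -/
theorem IsStep.isKKT (hP : P.Admissible Sy σ lamQ) {u v : State m n} {wh : E n}
    (h : P.IsStep Sy σ lamQ u v wh) (h1 : P.multiplier σ v = P.multiplier σ u)
    (h2 : Sy v.1 = Sy u.1) (h3 : P.Sw lamQ v.2.1 = P.Sw lamQ u.2.1)
    (h4 : P.Q (P.Astar v.1) = P.Q (P.Astar u.1)) :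
    P.IsKKT v.1 (P.projW v.2.1) v.2.2.1 v.2.2.2 := by
  have hσ := hP.sigma_pos
  have hc := hP.one_add_pos
  have hres : P.res v.1 v.2.1 v.2.2.1 = 0 := by
    have e : σ • P.res v.1 v.2.1 v.2.2.1 = P.multiplier σ v - P.multiplier σ u := by
      rw [multiplier, multiplier, h.x_step]
      simp only [res]
      module
    rw [h1, sub_self] at e
    exact (smul_eq_zero.1 e).resolve_left hσ.ne'
  have hwh : P.Q wh = P.Q v.2.1 := by
    have e := h.Q_w_eq
    rw [h4, sub_self, smul_zero, add_zero] at e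
    exact (smul_right_injective _ hc.ne' e).symm
  have hQx : P.Q v.2.1 = P.Q v.2.2.2 := by
    have e : P.Q v.2.1 - P.Q v.2.2.2 = ((1 + σ * lamQ) • P.Q v.2.1 -
        P.Q ((σ * lamQ) • u.2.1 + v.2.2.2 + σ • P.res v.1 u.2.1 v.2.2.1)) +
          σ • P.Q (P.res v.1 v.2.1 v.2.2.1) -
            σ • (P.Sw lamQ v.2.1 - P.Sw lamQ u.2.1) := by
      simp only [Sw, res, map_add, map_sub, map_smul, map_neg, ContinuousLinearMap.comp_apply,
        sub_apply, smul_apply, ContinuousLinearMap.id_apply]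
      module
    rw [h.w_step, hres, h3] at e
    simpa [sub_eq_zero] using e
  refine ⟨P.projW_mem _, ?_, ?_, h.z_step, ?_⟩
  · rw [P.Q_projW, hQx, sub_self]
  · have hy := h.y_step
    have e : P.res v.1 wh v.2.2.1 = P.res v.1 v.2.1 v.2.2.1 := by rw [res, hwh, res]
    rw [e, hres, map_sub, h2] at hy
    simpa using hy
  · rw [P.Q_projW]
    exact hres

theorem IsKKT.solvesDual {y : E m} {w z x : E n} (h : P.IsKKT y w z x) : P.SolvesDual y w z := by
  obtain ⟨hW, hQ, hy, hz, hr⟩ := h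
  obtain ⟨a, ha, hya⟩ := exists_coe_of_mem_subdiff hy
  obtain ⟨b, hb, hzb⟩ := exists_coe_of_mem_subdiff hz
  have hval : P.dualObj (y, w, z) = (((1 / 2) * inner ℝ w (P.Q w) + a + b : ℝ) : EReal) := by
    simp only [dualObj, ha, hb, EReal.coe_add]
  refine ⟨⟨sub_eq_zero.1 hr, hW⟩, ?_, isMinOn_iff.2 ?_⟩
  · rw [hval]
    exact EReal.coe_ne_top _
  rintro ⟨y', w', z'⟩ ⟨hr', -⟩
  rw [hval]
  have h1 : (((1 / 2) * inner ℝ w' (P.Q w') + (a + inner ℝ (P.A x) (-y' - -y)) +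
      (b + inner ℝ x (-z' - -z)) : ℝ) : EReal) ≤ P.dualObj (y', w', z') := by
    rw [EReal.coe_add, EReal.coe_add]
    exact add_le_add (add_le_add le_rfl (hya _)) (hzb _)
  refine le_trans ?_ h1
  rw [EReal.coe_le_coe_iff, ← inner_Astar_right]
  have hr'' : -P.Q w + P.Astar y + z = P.c := sub_eq_zero.1 hr
  have e1 : P.Astar (-y' - -y) + (-z' - -z) = -P.Q w' + P.Q w := by
    dsimp only at hr'
    have e : P.Astar (-y' - -y) + (-z' - -z) =
        (-P.Q w + P.Astar y + z) - (-P.Q w' + P.Astar y' + z') + (-P.Q w' + P.Q w) := by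
      simp only [map_sub, map_neg]; abel
    rw [e, hr', hr'', sub_self, zero_add]
  have e2 := congrArg (fun t => inner ℝ x t) e1
  have e3 : ∀ v, inner ℝ x (P.Q v) = inner ℝ w (P.Q v) := fun v => by
    rw [← inner_Q_left, ← inner_Q_left, sub_eq_zero.1 hQ]
  simp only [inner_add_right, inner_neg_right, e3] at e2
  have e4 := P.Q_pos.inner_nonneg_right (w' - w)
  simp only [map_sub, inner_sub_left, inner_sub_right] at e4
  have e5 : inner ℝ w' (P.Q w) = inner ℝ w (P.Q w') := by rw [← inner_Q_left, real_inner_comm]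
  linarith

theorem properClosedConvex_indicatorFun {d : ℕ} {C : Set (E d)} (hne : C.Nonempty)
    (hcl : IsClosed C) (hconv : Convex ℝ C) : ProperClosedConvex (indicatorFun C) := by
  classical
  have hle : ∀ x (t : ℝ), indicatorFun C x ≤ t ↔ x ∈ C ∧ 0 ≤ t := fun x t => by
    by_cases hx : x ∈ C <;> simp [indicatorFun, hx]
  refine ⟨fun x => ?_, ?_, ?_, ?_⟩
  · by_cases hx : x ∈ C <;> simp [indicatorFun, hx]
  · obtain ⟨x, hx⟩ := hne
    exact ⟨x, by simp [indicatorFun, hx]⟩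
  · rw [lowerSemicontinuous_iff_isClosed_preimage]
    intro t
    by_cases ht : t = ⊤
    · simp [ht]
    · by_cases h0 : 0 ≤ t
      · have : indicatorFun C ⁻¹' Iic t = C := by
          ext x
          by_cases hx : x ∈ C <;> simp [indicatorFun, hx, h0, ht]
        rwa [this]
      · have : indicatorFun C ⁻¹' Iic t = ∅ := by
          ext x
          by_cases hx : x ∈ C <;> simp [indicatorFun, hx, h0, ht]
        rw [this]
        exact isClosed_empty
  · have : {p : E d × ℝ | indicatorFun C p.1 ≤ (p.2 : EReal)} = C ×ˢ Ici 0 := by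
      ext p
      simp [hle]
    rw [this]
    exact hconv.prod (convex_Ici 0)

theorem isClosed_box {d : ℕ} (l u : Fin d → EReal) : IsClosed (box l u) := by
  have : box l u =
      ⋂ i, {y : E d | l i ≤ ((y i : ℝ) : EReal)} ∩ {y | ((y i : ℝ) : EReal) ≤ u i} := by
    ext y
    simp [box]
  rw [this]
  have hc : ∀ i, Continuous fun y : E d => ((y i : ℝ) : EReal) := fun i =>
    continuous_coe_real_ereal.comp (by fun_prop)
  exact isClosed_iInter fun i =>
    (isClosed_le continuous_const (hc i)).inter (isClosed_le (hc i) continuous_const)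

theorem convex_box {d : ℕ} (l u : Fin d → EReal) : Convex ℝ (box l u) := by
  intro y hy y' hy' s t hs ht hst i
  have h : Convex ℝ {r : ℝ | l i ≤ (r : EReal) ∧ (r : EReal) ≤ u i} := by
    refine OrdConnected.convex ⟨fun a ha b hb r hr => ⟨ha.1.trans ?_, le_trans ?_ hb.2⟩⟩
    · exact_mod_cast hr.1
    · exact_mod_cast hr.2
  exact h (hy i) (hy' i) hs ht hst

theorem IsKKT.solvesPrimal {y : E m} {w z x : E n} (h : P.IsKKT y w z x) : P.SolvesPrimal x := by
  obtain ⟨-, hQ, hy, hz, hr⟩ := h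
  have hKne : P.K.Nonempty := by
    by_contra hne
    rw [not_nonempty_iff_eq_empty] at hne
    refine hy.1 ?_
    simp [suppK, conj, indicatorFun, hne, sub_eq_add_neg]
  obtain ⟨a, b, ha, hb, hab⟩ := fenchel_young_eq P.phi_pcc hz
  obtain ⟨a', b', ha', hb', hab'⟩ := fenchel_young_eq
    (properClosedConvex_indicatorFun hKne (isClosed_box _ _) (convex_box _ _)) hy
  have hAx : P.A x ∈ P.K := by
    by_contra hn
    simp [indicatorFun, hn] at ha'
  have ha0 : a' = 0 := by
    have : ((0 : ℝ) : EReal) = a' := by simpa [indicatorFun, hAx] using ha'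
    exact_mod_cast this.symm
  refine ⟨hAx, ?_, isMinOn_iff.2 fun x' hx' => ?_⟩
  · rw [primalObj, ha, ← EReal.coe_add]
    exact EReal.coe_ne_top _
  rw [primalObj, primalObj, ha]
  induction hphi : P.phi x' with
  | bot => exact absurd hphi (P.phi_pcc.ne_bot x')
  | top =>
    rw [EReal.coe_add_top]
    exact le_top
  | coe r =>
    rw [← EReal.coe_add, ← EReal.coe_add, EReal.coe_le_coe_iff]
    have h1 := inner_sub_le_conj P.phi x' (-z)
    rw [hphi, hb, ← EReal.coe_sub, EReal.coe_le_coe_iff, inner_neg_right] at h1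
    have h2 := inner_sub_le_conj (indicatorFun P.K) (P.A x') (-y)
    have hx'' : P.A x' ∈ P.K := hx'
    simp only [indicatorFun, hx'', if_true, sub_zero] at h2
    have h2' : inner ℝ (P.A x') (-y) ≤ b' := by
      rw [← EReal.coe_le_coe_iff]
      exact h2.trans hb'.le
    rw [inner_neg_right] at h2' hab hab'
    have hz' : z = P.c + P.Q x - P.Astar y := by
      have e : z = (-P.Q w + P.Astar y + z - P.c) + (P.c + P.Q w - P.Astar y) := by abel
      rw [e, hr, sub_eq_zero.1 hQ, zero_add]
    rw [hz', inner_sub_right, inner_add_right, inner_Astar_right] at h1 hab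
    have e4 := P.Q_pos.inner_nonneg_right (x' - x)
    simp only [map_sub, inner_sub_left, inner_sub_right] at e4
    have e5 : inner ℝ x (P.Q x') = inner ℝ x' (P.Q x) := by rw [← inner_Q_left, real_inner_comm]
    rw [real_inner_comm P.c x, real_inner_comm P.c x'] at *
    linarith

end CCQP

/-! ### Existence and uniqueness of the generated sequences -/

/-- The iterate `u^k`. -/
def Iterates.state {m n : ℕ} (r : Iterates m n) (k : ℕ) : CCQP.State m n :=
  (r.y k, r.w k, r.z k, r.x k)

/-- The iterate `ū^{k+1}`. -/
def Iterates.barState {m n : ℕ} (r : Iterates m n) (k : ℕ) : CCQP.State m n :=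
  (r.ybar k, r.wbar k, r.zbar k, r.xbar k)

theorem Iterates.halpernSteps_iff {m n : ℕ} {r : Iterates m n} :
    r.HalpernSteps ↔
      ∀ k, r.state (k + 1) = halpern k (r.state 0) (r.state k) (r.barState k) := by
  simp [HalpernSteps, state, barState, halpern, Prod.ext_iff]

theorem Iterates.eq_of_states {m n : ℕ} {r r' : Iterates m n} (h : ∀ k, r.state k = r'.state k)
    (hbar : ∀ k, r.barState k = r'.barState k) (hhalf : ∀ k, r.whalf k = r'.whalf k) : r = r' := by
  cases r
  cases r'
  simp only [state, barState, Prod.mk.injEq, forall_and] at h hbar hhalf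
  simp only [Iterates.mk.injEq, funext_iff]
  exact ⟨h.1, h.2.1, h.2.2.1, h.2.2.2, hbar.1, hhalf, hbar.2.1, hbar.2.2.1, hbar.2.2.2⟩

namespace CCQP

variable {m n : ℕ} (P : CCQP m n) (Sy : E m →L[ℝ] E m) (σ lamQ : ℝ) (π : E n → E n)

/-- The solution of the `z`-subproblem. -/
noncomputable def zSol (y : E m) (w x : E n) : E n :=
  Classical.epsilon fun zb => P.ArgminZ σ y w x zb

/-- The solution of the `y`-subproblem. -/
noncomputable def ySol (y0 : E m) (w z x : E n) : E m :=
  Classical.epsilon fun yb => P.ArgminY σ Sy y0 w z x yb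

/-- The multiplier `x̄` computed from `u`. -/
noncomputable def xStep (u : State m n) : E n :=
  u.2.2.2 + σ • P.res u.1 u.2.1 (P.zSol σ u.1 u.2.1 u.2.2.2)

/-- The first update of the `w`-block from `u`, where `π` is applied to the explicit formula. -/
noncomputable def halfStep (u : State m n) : E n :=
  π (P.wUpdate σ lamQ u.2.1 u.1 (P.zSol σ u.1 u.2.1 u.2.2.2) (P.xStep σ u))

/-- The update of the `y`-block from `u`. -/
noncomputable def yStep (u : State m n) : E m :=
  P.ySol Sy σ u.1 (P.halfStep σ lamQ π u) (P.zSol σ u.1 u.2.1 u.2.2.2) (P.xStep σ u)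

/-- The map `u ↦ ū`. With `π` the identity it is the map of the easy-to-implement method, with `π`
the projection onto `W` the one of the method with the symmetric Gauss-Seidel technique. -/
noncomputable def stepMap (u : State m n) : State m n :=
  (P.yStep Sy σ lamQ π u,
    π (P.wUpdate σ lamQ u.2.1 (P.yStep Sy σ lamQ π u) (P.zSol σ u.1 u.2.1 u.2.2.2) (P.xStep σ u)),
    P.zSol σ u.1 u.2.1 u.2.2.2, P.xStep σ u)

/-- The sequences generated by `stepMap` and the Halpern averaging. -/
structure IsRun (r : Iterates m n) : Prop where
  whalf_eq : ∀ k, r.whalf k = P.halfStep σ lamQ π (r.state k)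
  barState_eq : ∀ k, r.barState k = P.stepMap Sy σ lamQ π (r.state k)
  state_succ : ∀ k, r.state (k + 1) = halpern k (r.state 0) (r.state k) (r.barState k)

variable {P Sy σ lamQ π}

theorem existsUnique_isRun (u0 : State m n) :
    ∃! r : Iterates m n, P.IsRun Sy σ lamQ π r ∧ r.start = u0 := by
  let s : ℕ → State m n := fun k =>
    Nat.rec u0 (fun k u => halpern k u0 u (P.stepMap Sy σ lamQ π u)) k
  have huniq : ∀ r : Iterates m n, P.IsRun Sy σ lamQ π r → r.start = u0 → ∀ k, r.state k = s k := by
    intro r hr h0 k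
    induction k with
    | zero => exact h0
    | succ k ih =>
      rw [hr.state_succ, hr.barState_eq, ih, show r.state 0 = u0 from h0]
  let r : Iterates m n :=
    { y := fun k => (s k).1
      w := fun k => (s k).2.1
      z := fun k => (s k).2.2.1
      x := fun k => (s k).2.2.2
      ybar := fun k => (P.stepMap Sy σ lamQ π (s k)).1
      whalf := fun k => P.halfStep σ lamQ π (s k)
      wbar := fun k => (P.stepMap Sy σ lamQ π (s k)).2.1
      zbar := fun k => (P.stepMap Sy σ lamQ π (s k)).2.2.1
      xbar := fun k => (P.stepMap Sy σ lamQ π (s k)).2.2.2 }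
  have hr : P.IsRun Sy σ lamQ π r := ⟨fun _ => rfl, fun _ => rfl, fun _ => rfl⟩
  refine ⟨r, ⟨hr, rfl⟩, fun r' ⟨hr', h0⟩ => ?_⟩
  have h := huniq r' hr' h0
  refine Iterates.eq_of_states h (fun k => ?_) fun k => ?_
  · rw [hr'.barState_eq, h]
    rfl
  · rw [hr'.whalf_eq, h]

namespace Admissible

variable (hP : P.Admissible Sy σ lamQ)
include hP

theorem argminZ_iff {y : E m} {w x zb : E n} :
    P.ArgminZ σ y w x zb ↔ zb = P.zSol σ y w x := by
  have h := hP.existsUnique_argminZ y w x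
  have hs : P.ArgminZ σ y w x (P.zSol σ y w x) := Classical.epsilon_spec h.exists
  exact ⟨fun h' => h.unique h' hs, fun h' => h' ▸ hs⟩

theorem argminY_iff {y0 yb : E m} {w z x : E n} :
    P.ArgminY σ Sy y0 w z x yb ↔ yb = P.ySol Sy σ y0 w z x := by
  have h := hP.existsUnique_argminY y0 w z x
  have hs : P.ArgminY σ Sy y0 w z x (P.ySol Sy σ y0 w z x) := Classical.epsilon_spec h.exists
  exact ⟨fun h' => h.unique h' hs, fun h' => h' ▸ hs⟩

/-- The steps of a method whose `w`-updates are `π` of the explicit formula, in terms of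
`stepMap`. -/
theorem isRun_iff {r : Iterates m n} : P.IsRun Sy σ lamQ π r ↔
    (∀ k, P.ArgminZ σ (r.y k) (r.w k) (r.x k) (r.zbar k)) ∧
    (∀ k, r.xbar k = r.x k + σ • P.res (r.y k) (r.w k) (r.zbar k)) ∧
    (∀ k, r.whalf k = π (P.wUpdate σ lamQ (r.w k) (r.y k) (r.zbar k) (r.xbar k))) ∧
    (∀ k, P.ArgminY σ Sy (r.y k) (r.whalf k) (r.zbar k) (r.xbar k) (r.ybar k)) ∧
    (∀ k, r.wbar k = π (P.wUpdate σ lamQ (r.w k) (r.ybar k) (r.zbar k) (r.xbar k))) ∧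
    r.HalpernSteps := by
  simp only [hP.argminZ_iff, hP.argminY_iff, Iterates.halpernSteps_iff]
  constructor
  · rintro ⟨h1, h2, h3⟩
    have hb := fun k => Prod.ext_iff.1 (h2 k)
    have hy : ∀ k, r.ybar k = P.yStep Sy σ lamQ π (r.state k) := fun k => (hb k).1
    have hw : ∀ k, r.wbar k = _ := fun k => (Prod.ext_iff.1 (hb k).2).1
    have hz : ∀ k, r.zbar k = P.zSol σ (r.y k) (r.w k) (r.x k) :=
      fun k => (Prod.ext_iff.1 (Prod.ext_iff.1 (hb k).2).2).1
    have hx : ∀ k, r.xbar k = P.xStep σ (r.state k) :=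
      fun k => (Prod.ext_iff.1 (Prod.ext_iff.1 (hb k).2).2).2
    refine ⟨hz, fun k => ?_, fun k => ?_, fun k => ?_, fun k => ?_, h3⟩
    · rw [hx, hz]; rfl
    · rw [h1, hx, hz]; rfl
    · rw [hy, h1, hx, hz]; rfl
    · rw [hw, hy, hx, hz]; rfl
  · rintro ⟨hz, hx, hh, hy, hw, h3⟩
    have hx' : ∀ k, r.xbar k = P.xStep σ (r.state k) := fun k => by rw [hx, hz]; rfl
    have hh' : ∀ k, r.whalf k = P.halfStep σ lamQ π (r.state k) := fun k => by
      rw [hh, hx', hz]; rfl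
    have hy' : ∀ k, r.ybar k = P.yStep Sy σ lamQ π (r.state k) := fun k => by
      rw [hy, hh', hx', hz]; rfl
    refine ⟨hh', fun k => ?_, h3⟩
    rw [Iterates.barState, hw, hy', hx', hz]; rfl

theorem isEasyRun_iff {r : Iterates m n} :
    P.IsEasyRun σ Sy lamQ r ↔ P.IsRun Sy σ lamQ id r := by
  rw [hP.isRun_iff]
  exact ⟨fun h => ⟨h.1, h.2, h.3, h.4, h.5, h.6⟩, fun ⟨h1, h2, h3, h4, h5, h6⟩ =>
    ⟨h1, h2, h3, h4, h5, h6⟩⟩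

theorem isSGSRun_iff {r : Iterates m n} :
    P.IsSGSRun σ Sy (P.Sw lamQ) r ↔ r.w 0 ∈ P.W ∧ P.IsRun Sy σ lamQ P.projW r := by
  rw [hP.isRun_iff]
  exact ⟨fun h => ⟨h.1, h.2, h.3, fun k => hP.argminW_iff.1 (h.4 k), h.5,
    fun k => hP.argminW_iff.1 (h.6 k), h.7⟩, fun ⟨h0, h1, h2, h3, h4, h5, h6⟩ =>
    ⟨h0, h1, h2, fun k => hP.argminW_iff.2 (h3 k), h4, fun k => hP.argminW_iff.2 (h5 k), h6⟩⟩

theorem isStep_stepMap (hπ : ∀ v, P.Q (π v) = P.Q v) (u : State m n) :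
    P.IsStep Sy σ lamQ u (P.stepMap Sy σ lamQ π u) (P.halfStep σ lamQ π u) := by
  refine ⟨?_, rfl, ?_, ?_, ?_⟩
  · exact hP.mem_subdiff_of_argminZ (hP.argminZ_iff.2 rfl)
  · rw [halfStep, hπ, hP.Q_wUpdate]; rfl
  · exact hP.mem_subdiff_of_argminY (hP.argminY_iff.2 rfl)
  · rw [stepMap, hπ, hP.Q_wUpdate]

/-! ### Convergence -/

/-- Two methods whose `w`-updates agree up to the kernel of `Q` generate the same outputs, since the
other updates depend on `w` through `Q w` only. -/
theorem output_eq {π' : E n → E n} (hπ : ∀ v, P.Q (π v) = P.Q v) (hπ' : ∀ v, P.Q (π' v) = P.Q v)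
    {r r' : Iterates m n} (hr : P.IsRun Sy σ lamQ π r) (hr' : P.IsRun Sy σ lamQ π' r')
    (h0 : P.imageState (r.state 0) = P.imageState (r'.state 0)) (k : ℕ) :
    P.output r k = P.output r' k := by
  have hstep : ∀ k, P.imageState (r.state k) = P.imageState (r'.state k) →
      P.imageState (r.barState k) = P.imageState (r'.barState k) := fun k hk => by
    rw [hr.barState_eq, hr'.barState_eq]
    exact (hP.isStep_stepMap hπ _).imageState_eq hP (hP.isStep_stepMap hπ' _) hk
  have hlin : ∀ (k : ℕ) (u v w : State m n), P.imageState (halpern k u v w) =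
      halpern k (P.imageState u) (P.imageState v) (P.imageState w) := fun k u v w => by
    simp [imageState, halpern, Prod.ext_iff]
  refine hstep k ?_
  induction k with
  | zero => exact h0
  | succ k ih => rw [hr.state_succ, hr'.state_succ, hlin, hlin, h0, ih, hstep k ih]

/-- The map `u ↦ 2 ū - u` is nonexpansive for the seminorm of `proxForm`, and a KKT point is a fixed
point of it in this seminorm. So the Halpern iterates converge in this seminorm, and the points
`ū^{k+1}`, which depend continuously on the class of `u^k`, converge to a KKT point. -/
theorem exists_tendsto_output (hπ : ∀ v, P.Q (π v) = P.Q v) {r : Iterates m n}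
    (hr : P.IsRun Sy σ lamQ π r) :
    ∃ y w z x, P.IsKKT y w z x ∧ Tendsto (P.output r) atTop (𝓝 (y, P.Q w, z, x)) := by
  obtain ⟨k₁, k₂, k₃, k₄, Φ, hΦ, hcont⟩ := exists_inner_eq_proxForm hP
  set J := P.stepMap Sy σ lamQ π with hJ
  have hJs := hP.isStep_stepMap hπ
  have hfirm : ∀ {u₁ u₂ v₁ v₂ : State m n} {wh₁ wh₂ : E n}, P.IsStep Sy σ lamQ u₁ v₁ wh₁ →
      P.IsStep Sy σ lamQ u₂ v₂ wh₂ →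
        0 ≤ inner ℝ (Φ v₁ - Φ v₂) ((Φ u₁ - Φ u₂) - (Φ v₁ - Φ v₂)) := fun h₁ h₂ => by
    have := h₁.proxForm_sub_nonneg hP h₂
    rwa [← hΦ, map_sub, map_sub, map_sub, map_sub] at this
  obtain ⟨q, hq, hlim⟩ := exists_tendsto_halpern_seminorm Φ
    (F := fun u => (2 : ℝ) • J u - u) (u := r.state) (fun u v => by
      have h := hfirm (hJs u) (hJs v)
      have e : Φ ((2 : ℝ) • J u - u) - Φ ((2 : ℝ) • J v - v) =
          (2 : ℝ) • (Φ (J u) - Φ (J v)) - (Φ u - Φ v) := by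
        simp only [map_sub, map_smul]; module
      rw [e]
      refine le_of_sq_le_sq ?_ (norm_nonneg _)
      rw [inner_sub_right, real_inner_self_eq_norm_sq] at h
      rw [norm_sub_sq_real, norm_smul, inner_smul_left, mul_pow]
      simp only [Real.norm_ofNat, conj_trivial]
      linarith)
    (fun k => by rw [hr.state_succ, halpern, hr.barState_eq]) (by
      obtain ⟨y, w, z, x, hK⟩ := hP.kkt
      refine ⟨(y, w, z, x), ?_⟩
      have h := hfirm (isStep_of_isKKT hK) (hJs (y, w, z, x))
      rw [sub_self, zero_sub, inner_neg_right, neg_nonneg, real_inner_self_eq_norm_sq] at h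
      have h1 : Φ (y, w, z, x) = Φ (J (y, w, z, x)) := by
        have := le_antisymm h (sq_nonneg _)
        simpa [sub_eq_zero] using this
      rw [map_sub, map_smul, ← h1]
      module)
  have hq' : Φ (J q) = Φ q := by
    have e : (2 : ℝ) • Φ (J q) = (2 : ℝ) • Φ q := by
      rw [map_sub, map_smul] at hq
      rw [eq_add_of_sub_eq hq]
      module
    exact smul_right_injective _ two_ne_zero e
  obtain ⟨l1, l2, l3, l4⟩ := hcont _ _ hlim
  -- equal values of `Φ` give equal data, by continuity applied to a constant sequence
  obtain ⟨e1, e2, e3, e4⟩ := hcont (fun _ => J q) q (by rw [hq']; exact tendsto_const_nhds)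
  have hK : P.IsKKT (J q).1 (P.projW (J q).2.1) (J q).2.2.1 (J q).2.2.2 :=
    (hJs q).isKKT hP (tendsto_nhds_unique tendsto_const_nhds e1)
      (tendsto_nhds_unique tendsto_const_nhds e2) (tendsto_nhds_unique tendsto_const_nhds e3)
      (tendsto_nhds_unique tendsto_const_nhds e4)
  refine ⟨_, _, _, _, hK, ?_⟩
  rw [P.Q_projW]
  have hout : P.output r = fun k => P.imageState (J (r.state k)) := by
    funext k
    rw [hJ, ← hr.barState_eq]
    rfl
  rw [hout]
  exact IsStep.tendsto hP (fun k => hJs (r.state k)) (hJs q) l1 l2 l3 l4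

end Admissible

end CCQP

end DualHPR

theorem mainTheorem1 {m n : ℕ} (P : DualHPR.CCQP m n)
    (Sy : DualHPR.E m →L[ℝ] DualHPR.E m) (hSy : Sy.IsPositive)
    (hSyA : ∀ y : DualHPR.E m, y ≠ 0 → 0 < inner ℝ y (Sy y + P.A (P.Astar y)))
    (σ : ℝ) (hσ : 0 < σ)
    (lamQ : ℝ) (hlamQ : 0 < lamQ)
    (hlamQ_ge : ∀ μ : ℝ,
      Module.End.HasEigenvalue (P.Q : DualHPR.E n →ₗ[ℝ] DualHPR.E n) μ → μ ≤ lamQ)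
    (hKKT : ∃ y w z x, P.IsKKT y w z x) :
    -- both methods are well defined from every admissible initial point
    (∀ u0 : DualHPR.E m × DualHPR.E n × DualHPR.E n × DualHPR.E n, u0.2.1 ∈ P.W →
      ∃! r : DualHPR.Iterates m n, P.IsSGSRun σ Sy (P.Sw lamQ) r ∧ r.start = u0) ∧
    (∀ u0 : DualHPR.E m × DualHPR.E n × DualHPR.E n × DualHPR.E n,
      ∃! r : DualHPR.Iterates m n, P.IsEasyRun σ Sy lamQ r ∧ r.start = u0) ∧
    -- `Q (r.w 0) = Q (rQ.w 0)` holds in particular when the initial points are equal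
    (∀ r rQ : DualHPR.Iterates m n,
      P.IsSGSRun σ Sy (P.Sw lamQ) r → P.IsEasyRun σ Sy lamQ rQ →
      r.y 0 = rQ.y 0 → P.Q (r.w 0) = P.Q (rQ.w 0) → r.z 0 = rQ.z 0 → r.x 0 = rQ.x 0 →
      (∀ k, P.output rQ k = P.output r k) ∧
      ∃ y w z x, P.SolvesDual y w z ∧ P.SolvesPrimal x ∧
        Filter.Tendsto (P.output rQ) Filter.atTop (nhds (y, P.Q w, z, x)) ∧
        Filter.Tendsto (P.output r) Filter.atTop (nhds (y, P.Q w, z, x))) := by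
  have hP : P.Admissible Sy σ lamQ := ⟨hSy, hSyA, hσ, hlamQ, hlamQ_ge, hKKT⟩
  refine ⟨fun u0 hu0 => ?_, fun u0 => ?_, fun r rQ hr hrQ hy hw hz hx => ?_⟩
  · obtain ⟨r, ⟨hr, h0⟩, huniq⟩ :=
      DualHPR.CCQP.existsUnique_isRun (P := P) (Sy := Sy) (σ := σ) (lamQ := lamQ) (π := P.projW) u0
    have hW : r.w 0 ∈ P.W := by
      rw [← h0] at hu0
      exact hu0
    exact ⟨r, ⟨hP.isSGSRun_iff.2 ⟨hW, hr⟩, h0⟩, fun r' hr' =>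
      huniq r' ⟨(hP.isSGSRun_iff.1 hr'.1).2, hr'.2⟩⟩
  · simp only [hP.isEasyRun_iff]
    exact DualHPR.CCQP.existsUnique_isRun u0
  · replace hr := (hP.isSGSRun_iff.1 hr).2
    rw [hP.isEasyRun_iff] at hrQ
    have hout : ∀ k, P.output rQ k = P.output r k := by
      refine hP.output_eq (fun _ => rfl) P.Q_projW hrQ hr ?_
      simp only [DualHPR.CCQP.imageState, DualHPR.Iterates.state, hy, hw, hz, hx]
    obtain ⟨y, w, z, x, hK, hlim⟩ := hP.exists_tendsto_output (fun _ => rfl) hrQ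
    refine ⟨hout, y, w, z, x, hK.solvesDual, hK.solvesPrimal, hlim, ?_⟩
    rwa [← funext hout]
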